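/- **Setting.** Let $\mathbf N=\{1,2,\dots\}$ and let $\mathcal A$ be the ring of column-finite complex matrices $(a_{i,j})_{i,j\in\mathbf N}$ (equivalently, the endomorphism ring of the space of finitely supported columns). Let $\mathcal{DR}_0\subseteq\mathcal A$ be the subring of those $A=(a_{i,j})$ for which there are constants $C,c>0$ with $a_{i,j}=0$ whenever $i>Cj^c$, and $|a_{i,j}|\le Cj^c$ for all $i,j$. Let $S=\begin{pmatrix}0&-1\\1&0\end{pmatrix}$ and $T=\begin{pmatrix}1&1\\0&1\end{pmatrix}$. Define $b_0=b_1=1$ and $b_n=-\sum_{i+j=n,\ i,j\ge1}b_ib_j$ for $n\ge2$ (so $b_n=(-1)^{n-1}\mathrm{Cat}_{n-1}$ for $n\geq 1$), and $g(t)=\sum_{n\ge1}b_nt^n\in\mathbf C[[t]]$, so that $g^2+g=t$. For $X=\sum_n X^{(n)}t^n\in M_2(\mathbf C[[t]])$ let $\gamma^{-1}(X)\in\mathcal A$ be the block upper triangular matrix with $2\times2$ blocks whose $(s,r)$ block ($s,r\ge 0$) is $X^{(r-s)}$ for $s\le r$ and $0$ for $s>r$; $\gamma^{-1}$ is an injective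 ring homomorphism. * $\tau_1:\mathrm{SL}(2,\mathbf Z)\to\mathcal A^\times$ is the representation with $\tau_1(S)=\tilde S=\gamma^{-1}\begin{pmatrix}0&-1\\1&0\end{pmatrix}$ and $\tau_1(T)=\tilde J=\gamma^{-1}\begin{pmatrix}1&1+g(t)\\g(t)&1+t\end{pmatrix}$. * $\tau(Y)=P\tau_1(Y)P^{-1}$, where $P$ is the upper unitriangular matrix whose $n$-th row is the first row of $(\tilde J-I)^{n-1}$. * $\rho(Y)=Z^{-1}\psi(\tau(Y))Z$, where $\psi:\mathcal A\to\mathcal A$ is the ring homomorphism with $\psi(A)_{d2^{k-1},\,d2^{\ell-1}}=A_{k,\ell}$ for $d$ odd and $k,\ell\in\mathbf N$, and $\psi(A)_{i,j}=0$ if $i$ and $j$ have different odd parts; and $Z$ is the upper unitriangular matrix whose $2^kd$-th row ($d$ odd, $k\ge0$) is the $d$-th row of $(D-I)^k$, with $D$ the divisor matrix ($D_{i,j}=1$ if $i\mid j$, and $0$ otherwise). Let $W=\begin{pmatrix}0&1\\1&0\end{pmatrix}\in\mathrm{GL}(2,\mathbf Z)$ and $$W(t)=\frac{1}{\sqrt{t^2+4t+1}}\begin{pmatrix}-t&2g(t)+1\\2g(t)+1&t\end{pmatrix}\in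 M_2(\mathbf C[[t]]),$$ where $1/\sqrt{t^2+4t+1}$ is the power series with constant term $1$ whose square is $(t^2+4t+1)^{-1}$. **Proposition.** 1. $W(t)^2=I$ (so $W(t)\in\mathrm{GL}(2,\mathbf C[[t]])$) and $W(0)=W$; and there is a constant $C$ such that for every entry $w_{i,j}(t)=\sum_n r_nt^n$ of $W(t)$ and every $n\ge0$ one has $|r_n|\le2^{Cn}$. 2. The representation $\rho$ extends to a representation $\rho:\mathrm{GL}(2,\mathbf Z)\to\mathcal{DR}_0^\times$. More precisely, $\tau_1$, $\tau$ and $\rho$ extend to homomorphisms $\tau_1,\tau:\mathrm{GL}(2,\mathbf Z)\to\mathcal A^\times$ and $\rho:\mathrm{GL}(2,\mathbf Z)\to\mathcal{DR}_0^\times$ such that $\tau_1(W)=\gamma^{-1}(W(t))$ and, for all $Y\in\mathrm{GL}(2,\mathbf Z)$, $\tau(Y)=P\tau_1(Y)P^{-1}$ and $\rho(Y)=Z^{-1}\psi(\tau(Y))Z$. 3. For these extensions, none of $\tau_1(Y)$, $\tau(Y)$, $\rho(Y)$ is an integer matrix when $Y\in\mathrm{GL}(2,\mathbf Z)$ has determinant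 $-1$; in particular $\tau_1(W)$, $\tau(W)$ and $\rho(W)$ are not integer matrices. -/

import Mathlib

open scoped PowerSeries MatrixGroups

namespace DivisorMatrix

noncomputable section

/-! ### A homomorphism out of `SL(2, ℤ)` from its standard defining relations -/

section Presentation

variable {H : Type*} [Group H]

/-- The positive words in `T` and `T * S * T = !![1, 0; 1, 1]`, paired with their images. -/
def posWords (s t : H) : Submonoid (SL(2, ℤ) × H) :=
  Submonoid.closure {(ModularGroup.T, t),
    (ModularGroup.T * ModularGroup.S * ModularGroup.T, t * s * t)}

theorem posWords_spec (s t : H) {x : SL(2, ℤ) × H} (hx : x ∈ posWords s t) :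
    (1 ≤ x.1.1 0 0 ∧ 0 ≤ x.1.1 0 1 ∧ 0 ≤ x.1.1 1 0 ∧ 1 ≤ x.1.1 1 1) ∧
      (x.1.1 0 1 = 0 → x.1.1 1 0 = 0 → x.2 = 1) := by
  induction hx using Submonoid.closure_induction_left with
  | one => simp
  | mul_left y hy z hz ih =>
    obtain ⟨⟨h1, h2, h3, h4⟩, h5⟩ := ih
    rcases hy with rfl | rfl <;>
    · simp only [Prod.fst_mul, Prod.snd_mul, Matrix.SpecialLinearGroup.coe_mul,
        ModularGroup.coe_T, ModularGroup.coe_S, Matrix.mul_apply, Fin.sum_univ_two,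
        Matrix.of_apply, Matrix.cons_val', Matrix.cons_val_zero, Matrix.cons_val_one,
        Matrix.cons_val_fin_one]
      refine ⟨⟨by omega, by omega, by omega, by omega⟩, fun h h' => by omega⟩

/-- Normal forms `± R ^ e * M * S ^ b` with `M` a positive word and `R = S * T`. -/
def IsNormalForm (s t : H) (x : SL(2, ℤ) × H) : Prop :=
  ∃ a e b : ℕ, e < 3 ∧ b < 2 ∧ ∃ m ∈ posWords s t,
    x = ((ModularGroup.S, s) ^ 2) ^ a * ((ModularGroup.S, s) * (ModularGroup.T, t)) ^ e * m *
      (ModularGroup.S, s) ^ b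

theorem isNormalForm_closure {s t : H} (h1 : s ^ 4 = 1) (h3 : s ^ 2 = (s * t) ^ 3)
    {x : SL(2, ℤ) × H}
    (hx : x ∈ Subgroup.closure {((ModularGroup.S, s) : SL(2, ℤ) × H), (ModularGroup.T, t)}) :
    IsNormalForm s t x := by
  have e1 : ((ModularGroup.S, s) : SL(2, ℤ) × H) ^ 4 = 1 :=
    Prod.ext (by simp only [Prod.pow_mk, Prod.fst_one]; decide) h1
  have e3 : ((ModularGroup.S, s) : SL(2, ℤ) × H) ^ 2 =
      ((ModularGroup.S, s) * (ModularGroup.T, t)) ^ 3 :=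
    Prod.ext (by simp only [Prod.pow_mk, Prod.mk_mul_mk]; decide) h3
  unfold IsNormalForm
  have hT : (ModularGroup.T, t) ∈ posWords s t := Submonoid.subset_closure (by simp)
  have hL : ((ModularGroup.T, t) * (ModularGroup.S, s) * (ModularGroup.T, t) : SL(2, ℤ) × H) ∈
    posWords s t := Submonoid.subset_closure (by simp)
  have hcases : ∀ m ∈ posWords s t, m = 1 ∨ ∃ m' ∈ posWords s t, m = (ModularGroup.T, t) * m' ∨
      m = (ModularGroup.T, t) * (ModularGroup.S, s) * (ModularGroup.T, t) * m' := by
    intro m hm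
    induction hm using Submonoid.closure_induction_left with
    | one => exact Or.inl rfl
    | mul_left y hy z hz _ =>
      refine Or.inr ⟨z, hz, ?_⟩
      rcases hy with rfl | rfl
      · exact Or.inl rfl
      · exact Or.inr rfl
  generalize ((ModularGroup.S, s) : SL(2, ℤ) × H) = σ at *
  generalize ((ModularGroup.T, t) : SL(2, ℤ) × H) = θ at *
  generalize posWords s t = N at *
  set NF : SL(2, ℤ) × H → Prop := fun x => ∃ a e b : ℕ, e < 3 ∧ b < 2 ∧ ∃ m ∈ N,
    x = (σ ^ 2) ^ a * (σ * θ) ^ e * m * σ ^ b with hNF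
  have cσ : ∀ a, Commute σ ((σ ^ 2) ^ a) := fun a => ((Commute.refl σ).pow_right 2).pow_right a
  have cρ : ∀ a, Commute (σ * θ) ((σ ^ 2) ^ a) := fun a => by
    rw [e3]; exact ((Commute.refl _).pow_right 3).pow_right a
  have Kz : ∀ x, NF x → NF (σ ^ 2 * x) := by
    rintro x ⟨a, e, b, he, hb, m, hm, rfl⟩
    exact ⟨a + 1, e, b, he, hb, m, hm, by rw [pow_succ' (σ ^ 2) a]; group⟩
  have Kσ : ∀ x, NF x → NF (σ * x) := by
    rintro x ⟨a, e, b, he, hb, m, hm, rfl⟩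
    have key : σ * ((σ ^ 2) ^ a * (σ * θ) ^ e * m * σ ^ b) =
      (σ ^ 2) ^ a * (σ * ((σ * θ) ^ e * m * σ ^ b)) := by
      simp only [← mul_assoc, (cσ a).eq]
    rw [key]
    interval_cases e
    · rcases hcases m hm with rfl | ⟨m', hm', rfl | rfl⟩
      · interval_cases b
        · exact ⟨a, 0, 1, by omega, by omega, 1, hm, by simp⟩
        · exact ⟨a + 1, 0, 0, by omega, by omega, 1, hm, by simp [pow_succ]⟩
      · exact ⟨a, 1, b, by omega, hb, m', hm', by simp [mul_assoc]⟩
      · exact ⟨a, 2, b, by omega, hb, m', hm', by simp [mul_assoc, pow_two (σ * θ)]⟩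
    · exact ⟨a + 1, 0, b, by omega, hb, θ * m, N.mul_mem hT hm, by
        rw [pow_succ (σ ^ 2) a]
        simp only [pow_two, pow_one, pow_zero, mul_one, mul_assoc]⟩
    · exact ⟨a + 1, 0, b, by omega, hb, θ * σ * θ * m, N.mul_mem hL hm, by
        rw [pow_succ (σ ^ 2) a]
        simp only [pow_two, pow_zero, mul_one, mul_assoc]⟩
  have Kρ : ∀ x, NF x → NF (σ * θ * x) := by
    rintro x ⟨a, e, b, he, hb, m, hm, rfl⟩
    have key : σ * θ * ((σ ^ 2) ^ a * (σ * θ) ^ e * m * σ ^ b) =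
      (σ ^ 2) ^ a * ((σ * θ) ^ (e + 1) * m * σ ^ b) := by
      rw [pow_succ' (σ * θ) e]
      simp only [← mul_assoc]
      have := (cρ a).eq
      simp only [← mul_assoc] at this
      rw [this]
    rw [key]
    by_cases h : e = 2
    · subst h
      refine ⟨a + 1, 0, b, by omega, hb, m, hm, ?_⟩
      rw [show 2 + 1 = 3 from rfl, ← e3, pow_succ (σ ^ 2) a]
      simp [mul_assoc]
    · exact ⟨a, e + 1, b, by omega, hb, m, hm, by simp [mul_assoc]⟩
  have iσ : σ⁻¹ = σ ^ 2 * σ := by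
    rw [inv_eq_iff_mul_eq_one, ← pow_succ, ← pow_succ', e1]
  have iρ : (σ * θ)⁻¹ = σ ^ 2 * ((σ * θ) * (σ * θ)) := by
    rw [inv_eq_iff_mul_eq_one, e3, ← pow_two, ← pow_add, ← pow_succ', show 3 + 2 + 1 = 3 * 2 from rfl,
      pow_mul, ← e3, ← pow_mul, e1]
  have Kσ' : ∀ x, NF x → NF (σ⁻¹ * x) := fun x hx => by
    rw [iσ, mul_assoc]; exact Kz _ (Kσ _ hx)
  have Kρ' : ∀ x, NF x → NF ((σ * θ)⁻¹ * x) := fun x hx => by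
    rw [iρ, mul_assoc, mul_assoc]; exact Kz _ (Kρ _ (Kρ _ hx))
  induction hx using Subgroup.closure_induction_left with
  | one => exact ⟨0, 0, 0, by omega, by omega, 1, N.one_mem, by simp⟩
  | mul_left y hy z hz ih =>
    rcases hy with rfl | rfl
    · exact Kσ _ ih
    · have := Kσ' _ (Kρ _ ih)
      rwa [mul_assoc, inv_mul_cancel_left] at this
  | inv_mul_cancel y hy z hz ih =>
    rcases hy with rfl | rfl
    · exact Kσ' _ ih
    · have := Kρ' _ (Kσ _ ih)
      rwa [mul_inv_rev, mul_assoc, inv_mul_cancel_left] at this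

theorem eq_one_of_mem_closure {s t : H} (h1 : s ^ 4 = 1) (h3 : s ^ 2 = (s * t) ^ 3) {h : H}
    (hx : ((1, h) : SL(2, ℤ) × H) ∈
      Subgroup.closure {((ModularGroup.S, s) : SL(2, ℤ) × H), (ModularGroup.T, t)}) : h = 1 := by
  obtain ⟨a, e, b, he, hb, m, hm, hxe⟩ := isNormalForm_closure h1 h3 hx
  obtain ⟨⟨p1, p2, p3, p4⟩, p5⟩ := posWords_spec s t hm
  have hpar : ((ModularGroup.S, s) ^ 2) ^ a = (1 : SL(2, ℤ) × H) ∨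
      ((ModularGroup.S, s) ^ 2) ^ a = ((ModularGroup.S, s) : SL(2, ℤ) × H) ^ 2 := by
    have e1 : (((ModularGroup.S, s) : SL(2, ℤ) × H) ^ 2) ^ 2 = 1 :=
      Prod.ext (by simp only [Prod.pow_mk, Prod.fst_one]; decide)
        (by simpa [← pow_mul] using h1)
    rcases Nat.even_or_odd' a with ⟨k, rfl | rfl⟩
    · left; rw [pow_mul, e1, one_pow]
    · right; rw [pow_succ, pow_mul, e1, one_pow, one_mul]
  have hfst : ∀ i j, ((1 : SL(2, ℤ)) : Matrix (Fin 2) (Fin 2) ℤ) i j =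
    ((((ModularGroup.S, s) ^ 2) ^ a * ((ModularGroup.S, s) * (ModularGroup.T, t)) ^ e * m *
      (ModularGroup.S, s) ^ b : SL(2, ℤ) × H).1 : Matrix (Fin 2) (Fin 2) ℤ) i j :=
    fun i j => by rw [← hxe]
  have hsnd := congrArg Prod.snd hxe
  have q00 := hfst 0 0
  have q01 := hfst 0 1
  have q10 := hfst 1 0
  have q11 := hfst 1 1
  rcases hpar with hp | hp <;> rw [hp] at q00 q01 q10 q11 hsnd <;>
    interval_cases e <;> interval_cases b <;>
    simp only [pow_two, pow_zero, pow_one, one_mul, mul_one, Prod.fst_mul, Prod.snd_mul,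
      Matrix.SpecialLinearGroup.coe_mul, Matrix.SpecialLinearGroup.coe_one, Matrix.one_apply,
      Matrix.mul_apply, Fin.sum_univ_two, ModularGroup.coe_T, ModularGroup.coe_S,
      Matrix.of_apply, Matrix.cons_val', Matrix.cons_val_zero, Matrix.cons_val_one,
      Matrix.cons_val_fin_one, if_true, zero_ne_one, one_ne_zero, if_false]
      at q00 q01 q10 q11 hsnd <;>
    first
    | omega
    | (rw [hsnd]; exact p5 (by omega) (by omega))

theorem exists_lift (s t : H) (h1 : s ^ 4 = 1) (h3 : s ^ 2 = (s * t) ^ 3) :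
    ∃ f : SL(2, ℤ) →* H, f ModularGroup.S = s ∧ f ModularGroup.T = t := by
  set Γ := Subgroup.closure {((ModularGroup.S, s) : SL(2, ℤ) × H), (ModularGroup.T, t)} with hΓ
  have hS : (ModularGroup.S, s) ∈ Γ := Subgroup.subset_closure (by simp)
  have hT : (ModularGroup.T, t) ∈ Γ := Subgroup.subset_closure (by simp)
  have hsurj : ∀ y : SL(2, ℤ), ∃ h, (y, h) ∈ Γ := by
    intro y
    have hy : y ∈ Subgroup.closure {ModularGroup.S, ModularGroup.T} := by
      rw [SpecialLinearGroup.SL2Z_generators]; trivial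
    have hle : Subgroup.closure {ModularGroup.S, ModularGroup.T} ≤
        Γ.map (MonoidHom.fst (SL(2, ℤ)) H) := by
      rw [Subgroup.closure_le]
      rintro _ (rfl | rfl)
      · exact ⟨_, hS, rfl⟩
      · exact ⟨_, hT, rfl⟩
    obtain ⟨x, hx, rfl⟩ := hle hy
    exact ⟨x.2, hx⟩
  have huniq : ∀ {y h h'}, (y, h) ∈ Γ → (y, h') ∈ Γ → h = h' := by
    intro y h h' hh hh'
    have := Γ.mul_mem hh (Γ.inv_mem hh')
    rw [Prod.inv_mk, Prod.mk_mul_mk, mul_inv_cancel] at this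
    exact mul_inv_eq_one.mp (eq_one_of_mem_closure h1 h3 this)
  choose f hf using hsurj
  exact ⟨MonoidHom.mk' f fun x y => huniq (hf _) (Γ.mul_mem (hf x) (hf y)),
    huniq (hf _) hS, huniq (hf _) hT⟩

/-- The homomorphism `SL(2, ℤ) → H` with `S ↦ s` and `T ↦ t`, for `s`, `t` satisfying the standard
defining relations. It is unique, as `S` and `T` generate `SL(2, ℤ)`. -/
def liftSL (s t : H) (h1 : s ^ 4 = 1) (h3 : s ^ 2 = (s * t) ^ 3) : SL(2, ℤ) →* H :=
  (exists_lift s t h1 h3).choose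

theorem liftSL_S (s t : H) (h1 : s ^ 4 = 1) (h3 : s ^ 2 = (s * t) ^ 3) :
    liftSL s t h1 h3 ModularGroup.S = s :=
  (exists_lift s t h1 h3).choose_spec.1

theorem liftSL_T (s t : H) (h1 : s ^ 4 = 1) (h3 : s ^ 2 = (s * t) ^ 3) :
    liftSL s t h1 h3 ModularGroup.T = t :=
  (exists_lift s t h1 h3).choose_spec.2

end Presentation

/-! ### The ring of column-finite matrices -/

/-- The ring of endomorphisms of the space `E` of finitely supported columns indexed by the
positive integers, i.e. of column-finite complex matrices. -/
abbrev ColFin : Type := Module.End ℂ (ℕ+ →₀ ℂ)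

/-- The `(i, j)` entry of the matrix of `A` in the standard basis. -/
def entry (A : ColFin) (i j : ℕ+) : ℂ := A (Finsupp.single j 1) i

/-- The endomorphism with a given column-finite matrix. -/
def ofMatrix (a : ℕ+ → ℕ+ → ℂ) (h : ∀ j, (Function.support fun i => a i j).Finite) : ColFin :=
  Finsupp.linearCombination ℂ fun j => Finsupp.ofSupportFinite (fun i => a i j) (h j)

@[simp] theorem entry_ofMatrix (a : ℕ+ → ℕ+ → ℂ) (h) (i j : ℕ+) :
    entry (ofMatrix a h) i j = a i j := by
  simp only [entry, ofMatrix, Finsupp.linearCombination_single, one_smul]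
  rfl

theorem ext_entry {A B : ColFin} (h : ∀ i j, entry A i j = entry B i j) : A = B := by
  refine Finsupp.lhom_ext' fun j => LinearMap.ext_ring ?_
  ext i
  exact h i j

theorem apply_eq_sum (A : ColFin) (v : ℕ+ →₀ ℂ) (i : ℕ+) {s : Finset ℕ+} (hs : v.support ⊆ s) :
    A v i = ∑ m ∈ s, entry A i m * v m := by
  have hv : v = ∑ m ∈ s, v m • Finsupp.single m (1 : ℂ) := by
    conv_lhs => rw [← Finsupp.sum_single v]
    rw [Finsupp.sum_of_support_subset _ hs _ (by simp)]
    simp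
  conv_lhs => rw [hv]
  rw [map_sum, Finsupp.finsetSum_apply]
  refine Finset.sum_congr rfl fun m _ => ?_
  rw [map_smul, Finsupp.smul_apply, smul_eq_mul, mul_comm]
  rfl

theorem entry_mul (A B : ColFin) (i j : ℕ+) {s : Finset ℕ+}
    (hs : ∀ m, entry B m j ≠ 0 → m ∈ s) :
    entry (A * B) i j = ∑ m ∈ s, entry A i m * entry B m j :=
  apply_eq_sum A (B (Finsupp.single j 1)) i fun m hm => hs m (Finsupp.mem_support_iff.mp hm)

theorem entry_one (i j : ℕ+) : entry 1 i j = if i = j then 1 else 0 := by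
  simp [entry, Finsupp.single_apply, eq_comm]

theorem entry_zero (i j : ℕ+) : entry 0 i j = 0 := rfl

theorem entry_add (A B : ColFin) (i j : ℕ+) : entry (A + B) i j = entry A i j + entry B i j := rfl

theorem entry_neg (A : ColFin) (i j : ℕ+) : entry (-A) i j = -entry A i j := rfl

theorem entry_sub (A B : ColFin) (i j : ℕ+) : entry (A - B) i j = entry A i j - entry B i j := by
  simp [entry]

/-- A column-finite matrix all of whose entries are (rational) integers. -/
def IsIntegerMatrix (A : ColFin) : Prop := ∀ i j, ∃ n : ℤ, entry A i j = n

/-! ### The ring `DR₀` -/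

/-- The polynomial growth conditions defining `DR₀`. -/
def PolyGrowth (A : ColFin) : Prop :=
  ∃ C c : ℝ, 0 < C ∧ 0 < c ∧
    (∀ i j : ℕ+, (i : ℝ) > C * (j : ℝ) ^ c → entry A i j = 0) ∧
    (∀ i j : ℕ+, ‖entry A i j‖ ≤ C * (j : ℝ) ^ c)

theorem one_le_cast (j : ℕ+) : (1 : ℝ) ≤ (j : ℝ) := by exact_mod_cast (one_le : 1 ≤ j)

/-- In the growth conditions one may take a single natural number, as large as desired, for both
constants. -/
theorem polyGrowth_iff (A : ColFin) : PolyGrowth A ↔ ∃ K₀ : ℕ, ∀ K : ℕ, K₀ ≤ K →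
    (∀ i j : ℕ+, entry A i j ≠ 0 → (i : ℝ) ≤ K * (j : ℝ) ^ K) ∧
    (∀ i j : ℕ+, ‖entry A i j‖ ≤ K * (j : ℝ) ^ K) := by
  constructor
  · rintro ⟨C, c, hC, hc, h1, h2⟩
    obtain ⟨K₀, hK⟩ := exists_nat_ge (max C c)
    refine ⟨K₀, fun K hKK => ?_⟩
    have hK' : (K₀ : ℝ) ≤ K := by exact_mod_cast hKK
    have key : ∀ j : ℕ+, C * (j : ℝ) ^ c ≤ K * (j : ℝ) ^ K := fun j => by
      rw [← Real.rpow_natCast]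
      have := one_le_cast j
      have := (le_max_left C c).trans (hK.trans hK')
      have := (le_max_right C c).trans (hK.trans hK')
      gcongr
    exact ⟨fun i j hij => (not_lt.mp fun h => hij (h1 i j h)).trans (key j),
      fun i j => (h2 i j).trans (key j)⟩
  · rintro ⟨K₀, hK⟩
    obtain ⟨h1, h2⟩ := hK (K₀ + 1) (by omega)
    refine ⟨(K₀ + 1 : ℕ), (K₀ + 1 : ℕ), by positivity, by positivity, ?_, ?_⟩
    · intro i j hij
      rw [Real.rpow_natCast] at hij
      by_contra h
      exact absurd (h1 i j h) (not_le.mpr hij)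
    · intro i j
      rw [Real.rpow_natCast]
      exact h2 i j

theorem PolyGrowth.mul {A B : ColFin} (hA : PolyGrowth A) (hB : PolyGrowth B) :
    PolyGrowth (A * B) := by
  rw [polyGrowth_iff] at hA hB
  obtain ⟨KA, hA⟩ := hA
  obtain ⟨KB, hB⟩ := hB
  set K := max KA KB + 1 with hKdef
  obtain ⟨a1, a2⟩ := hA K (by omega)
  obtain ⟨b1, b2⟩ := hB K (by omega)
  have hK1 : (1 : ℝ) ≤ K := by exact_mod_cast Nat.le_add_left 1 _
  have hex : ∀ j : ℕ+, ∃ M : ℕ+, (M : ℕ) = K * (j : ℕ) ^ K := fun j =>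
    ⟨⟨K * (j : ℕ) ^ K, by positivity⟩, rfl⟩
  choose M hM using hex
  have hsupp : ∀ j m : ℕ+, entry B m j ≠ 0 →
      m ∈ Finset.Icc 1 (M j) := fun j m hm => by
    rw [Finset.mem_Icc]
    refine ⟨one_le, ?_⟩
    rw [← PNat.coe_le_coe, hM]
    exact_mod_cast b1 m j hm
  have hpow : ∀ j m : ℕ+, (m : ℝ) ≤ K * (j : ℝ) ^ K →
      (K : ℝ) * (m : ℝ) ^ K ≤ K ^ (K + 1) * (j : ℝ) ^ (K * K) := fun j m hm => by
    calc (K : ℝ) * (m : ℝ) ^ K ≤ K * (K * (j : ℝ) ^ K) ^ K := by gcongr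
      _ = _ := by ring
  refine ⟨(K : ℝ) ^ (K + 3), ((K * K + 2 * K : ℕ) : ℝ), by positivity, by positivity, ?_, ?_⟩
  · intro i j hij
    rw [Real.rpow_natCast] at hij
    rw [entry_mul A B i j (hsupp j)]
    refine Finset.sum_eq_zero fun m _ => ?_
    by_contra hne
    have hAm := a1 i m (left_ne_zero_of_mul hne)
    have hBm := b1 m j (right_ne_zero_of_mul hne)
    refine absurd (hAm.trans (hpow j m hBm)) (not_le.mpr (lt_of_le_of_lt ?_ hij))
    have := one_le_cast j
    gcongr <;> omega
  · intro i j
    rw [Real.rpow_natCast, entry_mul A B i j (hsupp j)]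
    have hterm : ∀ m ∈ Finset.Icc 1 (M j),
        ‖entry A i m * entry B m j‖ ≤ K ^ (K + 1) * (j : ℝ) ^ (K * K) * (K * (j : ℝ) ^ K) := by
      intro m hm
      rw [norm_mul]
      have hm' : (m : ℝ) ≤ K * (j : ℝ) ^ K := by
        have := (Finset.mem_Icc.mp hm).2
        rw [← PNat.coe_le_coe, hM] at this
        exact_mod_cast this
      exact mul_le_mul ((a2 i m).trans (hpow j m hm')) (b2 m j) (norm_nonneg _) (by positivity)
    refine (norm_sum_le_of_le _ hterm).trans (le_of_eq ?_)
    rw [Finset.sum_const, PNat.card_Icc]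
    simp only [hM, PNat.one_coe, add_tsub_cancel_right, nsmul_eq_mul]
    push_cast
    ring

theorem PolyGrowth.add {A B : ColFin} (hA : PolyGrowth A) (hB : PolyGrowth B) :
    PolyGrowth (A + B) := by
  rw [polyGrowth_iff] at hA hB
  obtain ⟨KA, hA⟩ := hA
  obtain ⟨KB, hB⟩ := hB
  set K := max KA KB + 1 with hKdef
  obtain ⟨a1, a2⟩ := hA K (by omega)
  obtain ⟨b1, b2⟩ := hB K (by omega)
  have hK1 : (0 : ℝ) < K := by rw [hKdef]; positivity
  refine ⟨2 * K, K, by positivity, hK1, ?_, ?_⟩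
  · intro i j hij
    rw [Real.rpow_natCast] at hij
    have hlt : (K : ℝ) * (j : ℝ) ^ K < i := by
      have : (0 : ℝ) ≤ K * (j : ℝ) ^ K := by positivity
      linarith
    rw [entry_add]
    have hA0 : entry A i j = 0 := by
      by_contra h
      exact absurd (a1 i j h) (not_le.mpr hlt)
    have hB0 : entry B i j = 0 := by
      by_contra h
      exact absurd (b1 i j h) (not_le.mpr hlt)
    rw [hA0, hB0, add_zero]
  · intro i j
    rw [Real.rpow_natCast, entry_add]
    linarith [norm_add_le (entry A i j) (entry B i j), a2 i j, b2 i j]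

/-- The ring `DR₀` of column-finite matrices satisfying the polynomial growth conditions. -/
def DR0 : Subring ColFin where
  carrier := {A | PolyGrowth A}
  mul_mem' := PolyGrowth.mul
  one_mem' := by
    refine ⟨1, 1, one_pos, one_pos, fun i j hij => ?_, fun i j => ?_⟩
    · rw [entry_one, if_neg]
      rintro rfl
      simp at hij
    · rw [entry_one, Real.rpow_one, one_mul]
      have := one_le_cast j
      split_ifs
      · rw [norm_one]; exact this
      · rw [norm_zero]; linarith
  add_mem' := PolyGrowth.add
  zero_mem' := ⟨1, 1, one_pos, one_pos, fun _ _ _ => rfl, fun i j => by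
    rw [entry_zero, norm_zero]; positivity⟩
  neg_mem' := by
    rintro A ⟨C, c, hC, hc, h1, h2⟩
    exact ⟨C, c, hC, hc, fun i j hij => by rw [entry_neg, h1 i j hij, neg_zero],
      fun i j => by rw [entry_neg, norm_neg]; exact h2 i j⟩

/-! ### Upper unitriangular matrices -/

/-- A matrix with zeros below the diagonal and ones on the diagonal. -/
def IsUpperUnitriangular (a : ℕ+ → ℕ+ → ℂ) : Prop :=
  (∀ i j, j < i → a i j = 0) ∧ ∀ i, a i i = 1

theorem IsUpperUnitriangular.finite {a : ℕ+ → ℕ+ → ℂ} (h : IsUpperUnitriangular a) (j : ℕ+) :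
    (Function.support fun i => a i j).Finite :=
  (Set.finite_Iic j).subset fun i hi => by
    by_contra hij
    exact hi (h.1 i j (not_le.mp hij))

theorem IsUpperUnitriangular.isUnit {a : ℕ+ → ℕ+ → ℂ} (h : IsUpperUnitriangular a) :
    IsUnit (ofMatrix a h.finite) := by
  rw [Module.End.isUnit_iff]
  constructor
  · rw [injective_iff_map_eq_zero]
    intro v hv
    by_contra hne
    have hne' : v.support.Nonempty := Finsupp.support_nonempty_iff.mpr hne
    set m := v.support.max' hne' with hm
    have hmem : m ∈ v.support := Finset.max'_mem _ _
    have h0 : ofMatrix a h.finite v m = 0 := by rw [hv]; rfl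
    rw [apply_eq_sum _ v m subset_rfl, Finset.sum_eq_single_of_mem m hmem] at h0
    · rw [entry_ofMatrix, h.2, one_mul] at h0
      exact Finsupp.mem_support_iff.mp hmem h0
    · intro k hk hkm
      have : k < m := lt_of_le_of_ne (Finset.le_max' _ _ hk) hkm
      rw [entry_ofMatrix, h.1 _ _ this, zero_mul]
  · rw [← LinearMap.range_eq_top, eq_top_iff, ← Finsupp.span_single_eq_top, Submodule.span_le]
    have key : ∀ j : ℕ+, Finsupp.single j (1 : ℂ) ∈ LinearMap.range (ofMatrix a h.finite) := by
      intro j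
      induction j using PNat.strongInductionOn with
      | _ j ih =>
        have hj : Finsupp.single j (1 : ℂ) = ofMatrix a h.finite (Finsupp.single j 1) -
            ∑ m ∈ Finset.Iio j, a m j • Finsupp.single m (1 : ℂ) := by
          ext i
          have he : ofMatrix a h.finite (Finsupp.single j 1) i = a i j := entry_ofMatrix a _ i j
          rw [Finsupp.sub_apply, he, Finsupp.finsetSum_apply]
          simp only [Finsupp.smul_apply, Finsupp.single_apply, smul_eq_mul, mul_ite, mul_one,
            mul_zero, Finset.sum_ite_eq', Finset.mem_Iio]
          rcases lt_trichotomy i j with hij | rfl | hij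
          · rw [if_neg hij.ne', if_pos hij, sub_self]
          · rw [if_pos rfl, if_neg (lt_irrefl _), h.2, sub_zero]
          · rw [if_neg hij.ne, if_neg hij.not_gt, h.1 i j hij, sub_zero]
        rw [hj]
        exact Submodule.sub_mem _ (LinearMap.mem_range_self _ _)
          (Submodule.sum_mem _ fun m hm => Submodule.smul_mem _ _ (ih m (Finset.mem_Iio.mp hm)))
    rintro _ ⟨j, x, rfl⟩
    have := Submodule.smul_mem _ x (key j)
    rwa [Finsupp.smul_single, smul_eq_mul, mul_one] at this

/-- An upper unitriangular matrix, as a unit of the ring of column-finite matrices. -/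
def unitOfUpper (a : ℕ+ → ℕ+ → ℂ) (h : IsUpperUnitriangular a) : ColFinˣ := h.isUnit.unit

/-- Rows of powers: if `N i j = 0` for `j < f i` and `N i (f i) = 1`, with `f` strictly increasing,
then row `d` of `N ^ k` starts with an entry `1` in column `f^[k] d`. -/
theorem entry_pow {N : ColFin} {f : ℕ+ → ℕ+} (hf : StrictMono f)
    (h0 : ∀ i j, j < f i → entry N i j = 0) (h1 : ∀ i, entry N i (f i) = 1) (k : ℕ) (d : ℕ+) :
    (∀ j, j < f^[k] d → entry (N ^ k) d j = 0) ∧ entry (N ^ k) d (f^[k] d) = 1 := by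
  induction k with
  | zero => 
    refine ⟨fun j hj => ?_, ?_⟩
    · rw [pow_zero, entry_one, if_neg (by rintro rfl; simp at hj)]
    · rw [pow_zero, entry_one]; simp
  | succ k ih =>
    obtain ⟨ih0, ih1⟩ := ih
    have hcol : ∀ j m, entry N m j ≠ 0 → m ∈ Finset.Icc 1 j := fun j m hm => by
      rw [Finset.mem_Icc]
      refine ⟨one_le, ?_⟩
      by_contra hlt
      exact hm (h0 m j ((not_le.mp hlt).trans_le (hf.id_le m)))
    have hterm : ∀ j m, m ≠ f^[k] d → j ≤ f (f^[k] d) →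
        entry (N ^ k) d m * entry N m j = 0 := fun j m hm hj => by
      rcases lt_or_gt_of_ne hm with hlt | hgt
      · rw [ih0 m hlt, zero_mul]
      · rw [h0 m j (hj.trans_lt (hf hgt)), mul_zero]
    rw [Function.iterate_succ_apply', pow_succ]
    refine ⟨fun j hj => ?_, ?_⟩
    · rw [entry_mul _ _ _ _ (hcol j)]
      refine Finset.sum_eq_zero fun m _ => ?_
      by_cases hm : m = f^[k] d
      · rw [hm, h0 _ _ hj, mul_zero]
      · exact hterm j m hm hj.le
    · rw [entry_mul _ _ _ _ (hcol _), Finset.sum_eq_single_of_mem (f^[k] d)]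
      · rw [ih1, h1, one_mul]
      · exact hcol _ _ (by rw [h1]; exact one_ne_zero)
      · exact fun m _ hm => hterm _ m hm le_rfl

/-! ### The divisor matrix and its transition matrix `Z` -/

/-- The divisor matrix `D`. -/
def divisorMatrix : ColFin :=
  ofMatrix (fun i j => if (i : ℕ) ∣ (j : ℕ) then 1 else 0) fun j =>
    (Set.finite_Iic j).subset fun i hi => by
      by_contra hij
      exact hi (if_neg fun hd => hij (Nat.le_of_dvd j.pos hd))

/-- The exponent of the highest power of `2` dividing `i`. -/
def v2 (i : ℕ+) : ℕ := (i : ℕ).factorization 2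

/-- The odd part of `i`, so that `i = oddPart i * 2 ^ v2 i`. -/
def oddPart (i : ℕ+) : ℕ+ := ⟨(i : ℕ) / 2 ^ v2 i, Nat.ordCompl_pos 2 i.ne_zero⟩

theorem oddPart_mul (i : ℕ+) : oddPart i * 2 ^ v2 i = i := by
  apply PNat.coe_injective
  rw [PNat.mul_coe, PNat.pow_coe]
  exact Nat.div_mul_cancel (Nat.ordProj_dvd (i : ℕ) 2)

theorem eq_of_oddPart_eq {i j : ℕ+} (h : oddPart i = oddPart j) (h' : v2 i = v2 j) : i = j := by
  rw [← oddPart_mul i, ← oddPart_mul j, h, h']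

theorem exists_oddPart_v2 (i : ℕ+) (k : ℕ) : ∃ m, oddPart m = oddPart i ∧ v2 m = k := by
  have hodd : ¬ 2 ∣ (oddPart i : ℕ) := Nat.not_dvd_ordCompl Nat.prime_two i.ne_zero
  have hv : v2 (oddPart i * 2 ^ k) = k := by
    unfold v2
    rw [PNat.mul_coe, PNat.pow_coe, Nat.factorization_mul (oddPart i).ne_zero (by positivity)]
    simp [Nat.factorization_eq_zero_of_not_dvd hodd, Nat.prime_two.factorization_self]
  refine ⟨oddPart i * 2 ^ k, ?_, hv⟩
  have := oddPart_mul (oddPart i * 2 ^ k)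
  rw [hv] at this
  exact mul_right_cancel this

/-- The entries of `Z`: if `i = 2 ^ k * d` with `d` odd, the `i`-th row of `Z` is the `d`-th row of
`(D - 1) ^ k`. -/
def zEntry (i j : ℕ+) : ℂ := entry ((divisorMatrix - 1) ^ v2 i) (oddPart i) j

theorem zEntry_upper : IsUpperUnitriangular zEntry := by
  have hf : StrictMono fun i : ℕ+ => i * 2 := fun i j hij => mul_lt_mul_left hij 2
  have h0 : ∀ i j : ℕ+, j < i * 2 → entry (divisorMatrix - 1) i j = 0 := by
    intro i j hij
    rw [entry_sub, entry_one, divisorMatrix, entry_ofMatrix]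
    by_cases h : i = j
    · rw [if_pos h, if_pos (by rw [h]), sub_self]
    · rw [if_neg h, if_neg, sub_self]
      rw [← PNat.dvd_iff]
      rintro ⟨c, rfl⟩
      have hc : c < 2 := lt_of_mul_lt_mul_left' hij
      have : c = 1 := by
        apply PNat.coe_injective
        have h2 : (c : ℕ) < 2 := hc
        have := c.pos
        rw [PNat.one_coe]
        omega
      exact h (by rw [this, mul_one])
  have h1 : ∀ i : ℕ+, entry (divisorMatrix - 1) i (i * 2) = 1 := by
    intro i
    rw [entry_sub, entry_one, divisorMatrix, entry_ofMatrix, if_pos (PNat.dvd_iff.mp (Dvd.intro _ rfl)), if_neg,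
      sub_zero]
    intro h
    have := congrArg PNat.val h
    have hi := i.pos
    have h2 : ((i * 2 : ℕ+) : ℕ) = i * 2 := PNat.mul_coe i 2
    change (i : ℕ) = ((i * 2 : ℕ+) : ℕ) at this
    omega
  have hit : ∀ i : ℕ+, (fun i : ℕ+ => i * 2)^[v2 i] (oddPart i) = i := by
    intro i
    rw [mul_right_iterate]
    exact oddPart_mul i
  refine ⟨fun i j hij => ?_, fun i => ?_⟩
  · exact (entry_pow hf h0 h1 (v2 i) (oddPart i)).1 j (by rwa [hit])
  · have := (entry_pow hf h0 h1 (v2 i) (oddPart i)).2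
    rwa [hit] at this

/-- The matrix `Z`. -/
def matZ : ColFinˣ := unitOfUpper zEntry zEntry_upper

/-! ### Block Toeplitz matrices and matrices of power series -/

/-- The `2 × 2` block containing an index (blocks are numbered from `0`), and the position in it:
`2 * s + 1 ↦ (s, 0)` and `2 * s + 2 ↦ (s, 1)`. -/
def blockIndex : ℕ+ ≃ ℕ × Fin 2 := Equiv.pnatEquivNat.trans (Nat.divModEquiv 2)

theorem coe_eq_blockIndex (i : ℕ+) :
    (i : ℕ) = 2 * (blockIndex i).1 + ((blockIndex i).2 : ℕ) + 1 := by
  have h : (blockIndex i).1 = i.natPred / 2 ∧ ((blockIndex i).2 : ℕ) = i.natPred % 2 := by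
    simp [blockIndex, Nat.divModEquiv]
  have := PNat.natPred_add_one i
  omega

/-- The entries of the block upper triangular matrix whose `(s, r)` block, for `s ≤ r`, is the
coefficient of `t ^ (r - s)` in `X`. -/
def blockEntry (X : Matrix (Fin 2) (Fin 2) ℂ⟦X⟧) (i j : ℕ+) : ℂ :=
  if (blockIndex i).1 ≤ (blockIndex j).1 then
    PowerSeries.coeff ((blockIndex j).1 - (blockIndex i).1)
      (X (blockIndex i).2 (blockIndex j).2)
  else 0

/-- The indices whose block is at most the `r`-th one. -/
def blocksUpTo (r : ℕ) : Finset ℕ+ :=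
  ((Finset.range (r + 1)) ×ˢ (Finset.univ : Finset (Fin 2))).map blockIndex.symm.toEmbedding

theorem mem_blocksUpTo {r : ℕ} {i : ℕ+} : i ∈ blocksUpTo r ↔ (blockIndex i).1 ≤ r := by
  simp [blocksUpTo, Finset.mem_map_equiv]

theorem blockEntry_ne_zero {X : Matrix (Fin 2) (Fin 2) ℂ⟦X⟧} {i j : ℕ+}
    (h : blockEntry X i j ≠ 0) : i ∈ blocksUpTo (blockIndex j).1 := by
  rw [mem_blocksUpTo]
  by_contra hij
  exact h (if_neg hij)

theorem blockEntry_finite (X : Matrix (Fin 2) (Fin 2) ℂ⟦X⟧) (j : ℕ+) :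
    (Function.support fun i => blockEntry X i j).Finite :=
  (blocksUpTo (blockIndex j).1).finite_toSet.subset fun _ hi => blockEntry_ne_zero hi

/-- The ring homomorphism identifying `M₂(ℂ[[t]])` with the ring of block upper triangular block
Toeplitz matrices (the inverse of the isomorphism `γ`). -/
def gammaInv : Matrix (Fin 2) (Fin 2) ℂ⟦X⟧ →+* ColFin where
  toFun X := ofMatrix (blockEntry X) (blockEntry_finite X)
  map_one' := ext_entry fun i j => by
    rw [entry_ofMatrix, entry_one, blockEntry]
    by_cases hij : i = j
    · subst hij; simp
    · rw [if_neg hij]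
      split_ifs with h
      · rw [Matrix.one_apply]
        split_ifs with h'
        · rw [PowerSeries.coeff_one, if_neg]
          intro h0
          exact hij (blockIndex.injective (Prod.ext (by omega) h'))
        · simp
      · rfl
  map_mul' X Y := ext_entry fun i j => by
    rw [entry_mul (s := blocksUpTo (blockIndex j).1) _ _ _ _ fun m hm => by
      rw [entry_ofMatrix] at hm; exact blockEntry_ne_zero hm]
    simp only [entry_ofMatrix, blocksUpTo, Finset.sum_map, Equiv.coe_toEmbedding, blockEntry,
      Equiv.apply_symm_apply, Finset.sum_product]
    generalize blockIndex i = p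
    generalize blockIndex j = q
    obtain ⟨s, a⟩ := p
    obtain ⟨r, c⟩ := q
    dsimp only
    split_ifs with h
    · rw [Matrix.mul_apply, map_sum, Finset.sum_comm]
      refine Finset.sum_congr rfl fun e _ => ?_
      rw [PowerSeries.coeff_mul, Finset.Nat.sum_antidiagonal_eq_sum_range_succ
        (fun k l => PowerSeries.coeff k (X a e) * PowerSeries.coeff l (Y e c)),
        show r + 1 = s + (r - s + 1) by omega, Finset.sum_range_add]
      rw [Finset.sum_eq_zero (s := Finset.range s), zero_add]
      · refine Finset.sum_congr rfl fun k hk => ?_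
        have hk' := Finset.mem_range.mp hk
        rw [if_pos (by omega), if_pos (by omega)]
        congr 3 <;> omega
      · intro k hk
        have hk' := Finset.mem_range.mp hk
        rw [if_neg (by omega), zero_mul]
    · refine (Finset.sum_eq_zero fun k hk => Finset.sum_eq_zero fun e _ => ?_).symm
      have hk' := Finset.mem_range.mp hk
      rw [if_neg (by omega), zero_mul]
  map_zero' := ext_entry fun i j => by
    rw [entry_ofMatrix, entry_zero, blockEntry]; simp
  map_add' X Y := ext_entry fun i j => by
    rw [entry_add]
    simp only [entry_ofMatrix, blockEntry]
    split_ifs <;> simp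

/-! ### The representation `τ₁` -/

/-- The numbers `b₀ = b₁ = 1`, `bₙ = - ∑_{i + j = n, i, j ≥ 1} bᵢ bⱼ` for `n ≥ 2`, which are the
Catalan numbers up to sign. -/
def bSeq : ℕ → ℂ
  | 0 => 1
  | n + 1 => (-1) ^ n * catalan n

/-- The power series `g(t)` with `1 + g(t) = ∑ bₖ t ^ k`. -/
def gSeries : ℂ⟦X⟧ := PowerSeries.mk bSeq - 1

theorem gSeries_sq_add : gSeries ^ 2 + gSeries = PowerSeries.X := by
  set c : ℂ⟦X⟧ := PowerSeries.rescale (-1 : ℂ)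
    (PowerSeries.map (Nat.castRingHom ℂ) PowerSeries.catalanSeries) with hc
  have hg : gSeries = PowerSeries.X * c := by
    ext n
    rcases n with _ | n
    · simp [gSeries, bSeq]
    · rw [PowerSeries.coeff_succ_X_mul]
      simp [gSeries, bSeq, hc, PowerSeries.coeff_rescale, PowerSeries.coeff_one]
  have h := congrArg (fun f => PowerSeries.rescale (-1 : ℂ)
    (PowerSeries.map (Nat.castRingHom ℂ) f)) PowerSeries.catalanSeries_sq_mul_X_add_one
  simp only [map_add, map_mul, map_pow, map_one, PowerSeries.map_X, PowerSeries.rescale_X,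
    ← hc, map_neg] at h
  rw [hg]
  linear_combination (-PowerSeries.X : ℂ⟦X⟧) * h

theorem constantCoeff_gSeries : PowerSeries.constantCoeff gSeries = 0 := by
  rw [← PowerSeries.coeff_zero_eq_constantCoeff_apply, gSeries, map_sub, PowerSeries.coeff_mk,
    PowerSeries.coeff_one, if_pos rfl]
  exact sub_self 1

/-- The matrix `γ(S̃)`. -/
def St : SL(2, ℂ⟦X⟧) := ⟨!![0, -1; 1, 0], by simp [Matrix.det_fin_two]⟩

/-- The matrix `γ(J̃)`. -/
def Jt : SL(2, ℂ⟦X⟧) := ⟨!![1, 1 + gSeries; gSeries, 1 + PowerSeries.X], by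
  rw [Matrix.det_fin_two_of, ← gSeries_sq_add]; ring⟩

theorem St_sq : St ^ 2 = -1 := by
  apply Subtype.ext
  have h : ((St ^ 2 : SL(2, ℂ⟦X⟧)) : Matrix (Fin 2) (Fin 2) ℂ⟦X⟧) =
      -(1 : Matrix (Fin 2) (Fin 2) ℂ⟦X⟧) := by
    rw [pow_two, Matrix.SpecialLinearGroup.coe_mul, Matrix.one_fin_two]
    simp only [St, Matrix.mul_fin_two, Matrix.neg_of]
    congr!
    all_goals simp
  exact h

theorem St_Jt_cube : (St * Jt) ^ 3 = -1 := by
  apply Subtype.ext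
  have h : ((St * Jt : SL(2, ℂ⟦X⟧)) : Matrix (Fin 2) (Fin 2) ℂ⟦X⟧) =
      !![-gSeries, -(1 + PowerSeries.X); 1, 1 + gSeries] := by
    rw [Matrix.SpecialLinearGroup.coe_mul]
    simp only [St, Jt, Matrix.mul_fin_two]
    congr! 3 <;> ring_nf
  have h' : (((St * Jt) ^ 3 : SL(2, ℂ⟦X⟧)) : Matrix (Fin 2) (Fin 2) ℂ⟦X⟧) =
      -(1 : Matrix (Fin 2) (Fin 2) ℂ⟦X⟧) := by
    rw [Matrix.SpecialLinearGroup.coe_pow, h, pow_succ, pow_two, Matrix.mul_fin_two,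
      Matrix.mul_fin_two, Matrix.one_fin_two, ← gSeries_sq_add]
    ext i j : 2
    fin_cases i <;> fin_cases j <;>
      simp only [Fin.zero_eta, Fin.mk_one, Matrix.of_apply, Matrix.cons_val', Matrix.cons_val_zero,
        Matrix.cons_val_one, Matrix.cons_val_fin_one, Matrix.neg_apply] <;> ring_nf
  exact h'

theorem St_pow : St ^ 4 = 1 := by
  rw [show 4 = 2 * 2 from rfl, pow_mul, St_sq, neg_one_sq]

theorem St_sq_eq : St ^ 2 = (St * Jt) ^ 3 := by
  rw [St_sq, St_Jt_cube]

/-- The representation `τ₁` of `SL(2, ℤ)`, with `τ₁(S) = S̃` and `τ₁(T) = J̃`. -/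
def tau1 : SL(2, ℤ) →* ColFinˣ :=
  ((Units.map gammaInv.toMonoidHom).comp Matrix.SpecialLinearGroup.toGL).comp
    (liftSL St Jt St_pow St_sq_eq)

/-! ### The representation `τ` -/

/-- The matrix `J̃`. -/
def Jtilde : ColFin := gammaInv Jt.1

/-- The entries of `P`: the `n`-th row of `P` is the first row of `(J̃ - 1) ^ (n - 1)`. -/
def pEntry (n j : ℕ+) : ℂ := entry ((Jtilde - 1) ^ ((n : ℕ) - 1)) 1 j

theorem pEntry_upper : IsUpperUnitriangular pEntry := by
  have hf : StrictMono fun i : ℕ+ => i + 1 := fun i j hij => add_lt_add_left hij 1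
  have hJ : ∀ i j : ℕ+, entry (Jtilde - 1) i j =
      blockEntry (Jt.1) i j - if i = j then 1 else 0 := fun i j => by
    rw [entry_sub, entry_one]
    exact congrArg (· - _) (entry_ofMatrix _ _ i j)
  have hg0 : PowerSeries.coeff 0 gSeries = 0 := by
    rw [PowerSeries.coeff_zero_eq_constantCoeff_apply, constantCoeff_gSeries]
  have hg1 : PowerSeries.coeff 1 gSeries = 1 := by
    simp [gSeries, bSeq, PowerSeries.coeff_one]
  have h0 : ∀ i j : ℕ+, j < i + 1 → entry (Jtilde - 1) i j = 0 := by
    intro i j hij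
    have hij' : (j : ℕ) < i + 1 := hij
    have hi := coe_eq_blockIndex i
    have hj := coe_eq_blockIndex j
    have hinj : blockIndex i = blockIndex j → i = j := fun h => blockIndex.injective h
    rw [hJ, blockEntry]
    generalize blockIndex i = p at *
    generalize blockIndex j = q at *
    obtain ⟨s, a⟩ := p
    obtain ⟨r, c⟩ := q
    dsimp only at *
    have ha := a.isLt
    have hc := c.isLt
    rcases eq_or_ne i j with rfl | hne
    · obtain rfl : s = r := by omega
      obtain rfl : a = c := Fin.ext (by omega)
      fin_cases a <;> simp [Jt]
    · have hne' : (i : ℕ) ≠ j := fun h => hne (PNat.coe_injective h)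
      rw [if_neg hne, sub_zero]
      split_ifs with h
      · obtain rfl : s = r := by omega
        obtain rfl : a = 1 := Fin.ext (show (a : ℕ) = 1 by omega)
        obtain rfl : c = 0 := Fin.ext (show (c : ℕ) = 0 by omega)
        simpa [Jt] using hg0
      · rfl
  have h1 : ∀ i : ℕ+, entry (Jtilde - 1) i (i + 1) = 1 := by
    intro i
    have hne : i ≠ i + 1 := (PNat.lt_add_right i 1).ne
    have hi := coe_eq_blockIndex i
    have hj := coe_eq_blockIndex (i + 1)
    rw [hJ, blockEntry, if_neg hne, sub_zero]
    rw [PNat.add_coe, PNat.one_coe] at hj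
    generalize blockIndex i = p at *
    generalize blockIndex (i + 1) = q at *
    obtain ⟨s, a⟩ := p
    obtain ⟨r, c⟩ := q
    dsimp only at *
    have hc := c.isLt
    rw [if_pos (by omega)]
    fin_cases a
    · obtain rfl : c = 1 := Fin.ext (by simp at *; omega)
      obtain rfl : r = s := by
        simp at hi hj
        omega
      simpa [Jt] using constantCoeff_gSeries
    · obtain rfl : c = 0 := Fin.ext (by simp at *; omega)
      obtain rfl : r = s + 1 := by simp at *; omega
      simpa [Jt] using hg1
  have hit : ∀ n : ℕ+, (fun i : ℕ+ => i + 1)^[(n : ℕ) - 1] 1 = n := by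
    intro n
    induction n using PNat.recOn with
    | one => rfl
    | succ n ih =>
      have : ((n + 1 : ℕ+) : ℕ) - 1 = ((n : ℕ) - 1) + 1 := by
        have := n.pos
        rw [PNat.add_coe, PNat.one_coe]; omega
      rw [this, Function.iterate_succ_apply', ih]
  refine ⟨fun i j hij => ?_, fun i => ?_⟩
  · exact (entry_pow hf h0 h1 ((i : ℕ) - 1) 1).1 j (by rwa [hit])
  · have := (entry_pow hf h0 h1 ((i : ℕ) - 1) 1).2
    rwa [hit] at this

/-- The matrix `P`. -/
def matP : ColFinˣ := unitOfUpper pEntry pEntry_upper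

/-- The representation `τ(Y) = P * τ₁(Y) * P⁻¹` of `SL(2, ℤ)`. -/
def tau : SL(2, ℤ) →* ColFinˣ := (MulAut.conj matP).toMonoidHom.comp tau1

/-! ### The representation `ρ` -/

/-- The entries of `ψ(A)`: the `(i, j)` entry is `A k l` if `i = d * 2 ^ (k - 1)` and
`j = d * 2 ^ (l - 1)` for some odd `d`, and `0` if `i` and `j` have different odd parts. -/
def psiEntry (A : ColFin) (i j : ℕ+) : ℂ :=
  if oddPart i = oddPart j then entry A (v2 i).succPNat (v2 j).succPNat else 0

theorem psiEntry_finite (A : ColFin) (j : ℕ+) :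
    (Function.support fun i => psiEntry A i j).Finite := by
  refine Set.Finite.of_finite_image
    (f := fun i => (v2 i).succPNat) ((A (Finsupp.single (v2 j).succPNat 1)).hasFiniteSupport.subset ?_)
    ?_
  · rintro _ ⟨i, hi, rfl⟩ h0
    refine hi ?_
    simp only [psiEntry]
    split_ifs
    · exact h0
    · rfl
  · intro i hi k hk hik
    have hd : ∀ i, psiEntry A i j ≠ 0 → oddPart i = oddPart j := fun i hi => by
      by_contra h
      exact hi (if_neg h)
    exact eq_of_oddPart_eq ((hd i hi).trans (hd k hk).symm) (Nat.succPNat_injective hik)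

/-- The ring homomorphism `ψ`. -/
def psi : ColFin →+* ColFin where
  toFun A := ofMatrix (psiEntry A) (psiEntry_finite A)
  map_one' := ext_entry fun i j => by
    rw [entry_ofMatrix, psiEntry, entry_one, entry_one]
    by_cases hij : i = j
    · subst hij; simp
    · rw [if_neg hij]
      split_ifs with h h'
      · exact absurd (eq_of_oddPart_eq h (Nat.succPNat_injective h')) hij
      · rfl
      · rfl
  map_mul' A B := ext_entry fun i j => by
    set s := (psiEntry_finite B j).toFinset with hs
    have hmem : ∀ m, psiEntry B m j ≠ 0 → m ∈ s := fun m hm => by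
      rw [hs, Set.Finite.mem_toFinset]; exact hm
    have hmem' : ∀ m ∈ s, oddPart m = oddPart j := fun m hm => by
      rw [hs, Set.Finite.mem_toFinset] at hm
      by_contra h
      exact hm (if_neg h)
    rw [entry_mul (s := s) _ _ _ _ fun m hm => hmem m (by rwa [entry_ofMatrix] at hm)]
    simp only [entry_ofMatrix]
    by_cases hij : oddPart i = oddPart j
    · rw [psiEntry, if_pos hij, entry_mul (s := s.image fun m => (v2 m).succPNat)]
      · rw [Finset.sum_image]
        · refine Finset.sum_congr rfl fun m hm => ?_
          rw [psiEntry, psiEntry, if_pos (hij.trans (hmem' m hm).symm), if_pos (hmem' m hm)]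
        · intro m hm k hk hmk
          exact eq_of_oddPart_eq ((hmem' m hm).trans (hmem' k hk).symm)
            (Nat.succPNat_injective hmk)
      · intro k hk
        obtain ⟨m, hm1, hm2⟩ := exists_oddPart_v2 j k.natPred
        have hk' : (v2 m).succPNat = k := by rw [hm2, PNat.succPNat_natPred]
        refine Finset.mem_image.mpr ⟨m, hmem m ?_, hk'⟩
        rw [psiEntry, if_pos hm1, hk']
        exact hk
    · rw [psiEntry, if_neg hij]
      refine (Finset.sum_eq_zero fun m hm => ?_).symm
      rw [psiEntry, if_neg fun h => hij (h.trans (hmem' m hm)), zero_mul]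
  map_zero' := ext_entry fun i j => by
    rw [entry_ofMatrix, psiEntry]; simp [entry_zero]
  map_add' A B := ext_entry fun i j => by
    rw [entry_add]
    simp only [entry_ofMatrix, psiEntry]
    split_ifs <;> simp [entry_add]

/-- The representation `ρ(Y) = Z⁻¹ * ψ(τ(Y)) * Z` of `SL(2, ℤ)`. -/
def rho : SL(2, ℤ) →* ColFinˣ :=
  ((MulAut.conj matZ⁻¹).toMonoidHom.comp (Units.map psi.toMonoidHom)).comp tau

/-! ### The involution `W(t)` -/

/-- The element `W = !![0, 1; 1, 0]` of `GL(2, ℤ)`. -/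
def elemW : GL (Fin 2) ℤ where
  val := !![0, 1; 1, 0]
  inv := !![0, 1; 1, 0]
  val_inv := by decide
  inv_val := by decide

/-- The power series `1 / √(t ^ 2 + 4 t + 1)`, as the binomial series `(1 + u) ^ (-1 / 2)` at
`u = t ^ 2 + 4 t`. -/
def invSqrt : ℂ⟦X⟧ :=
  (PowerSeries.binomialSeries ℂ (-1 / 2 : ℚ)).subst
    (PowerSeries.X ^ 2 + 4 * PowerSeries.X : ℂ⟦X⟧)

theorem invSqrt_spec :
    invSqrt ^ 2 * (PowerSeries.X ^ 2 + 4 * PowerSeries.X + 1) = 1 ∧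
      PowerSeries.constantCoeff invSqrt = 1 := by
  have h0 : PowerSeries.constantCoeff (PowerSeries.X ^ 2 + 4 * PowerSeries.X : ℂ⟦X⟧) = 0 := by
    simp
  have hs : PowerSeries.HasSubst (PowerSeries.X ^ 2 + 4 * PowerSeries.X : ℂ⟦X⟧) :=
    PowerSeries.HasSubst.of_constantCoeff_zero' h0
  have h1 : (PowerSeries.binomialSeries ℂ (-1 / 2 : ℚ)) ^ 2 * (1 + PowerSeries.X) = 1 := by
    have hn := PowerSeries.binomialSeries_nat (R := ℚ) (A := ℂ) 1
    rw [pow_one] at hn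
    rw [pow_two, ← PowerSeries.binomialSeries_add, ← hn, ← PowerSeries.binomialSeries_add]
    norm_num
  constructor
  · have := congrArg (PowerSeries.subst (PowerSeries.X ^ 2 + 4 * PowerSeries.X : ℂ⟦X⟧)) h1
    rw [PowerSeries.subst_mul hs, PowerSeries.subst_pow hs, PowerSeries.subst_add hs,
      PowerSeries.subst_X hs] at this
    have hone : PowerSeries.subst (PowerSeries.X ^ 2 + 4 * PowerSeries.X : ℂ⟦X⟧) (1 : ℂ⟦X⟧) = 1 := by
      rw [← PowerSeries.coe_substAlgHom hs, map_one]
    rw [hone, add_comm 1] at this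
    exact this
  · set f := PowerSeries.binomialSeries ℂ (-1 / 2 : ℚ) with hf
    have hf0 : PowerSeries.constantCoeff (f - 1) = 0 := by
      rw [map_sub, hf, PowerSeries.binomialSeries_constantCoeff, map_one, sub_self]
    have h2 := PowerSeries.constantCoeff_subst_eq_zero h0 (f - 1) hf0
    have h3 : PowerSeries.subst (PowerSeries.X ^ 2 + 4 * PowerSeries.X : ℂ⟦X⟧) (f - 1) =
        invSqrt - 1 := by
      rw [← PowerSeries.coe_substAlgHom hs, map_sub, map_one, PowerSeries.coe_substAlgHom hs]
      rfl
    rw [h3] at h2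
    have h4 : PowerSeries.constantCoeff (invSqrt - 1) = 0 := h2
    rwa [map_sub, map_one, sub_eq_zero] at h4

/-- The matrix `W(t)`. -/
def Wt : Matrix (Fin 2) (Fin 2) ℂ⟦X⟧ :=
  invSqrt • !![-PowerSeries.X, 2 * gSeries + 1; 2 * gSeries + 1, PowerSeries.X]

end

end DivisorMatrix

open DivisorMatrix

namespace DivisorMatrix

/-!
The matrix `W(t)` is an involution that normalizes the image of `SL(2, ℤ)`: conjugation by `W(t)`
acts on `St` and `Jt` as conjugation by `W` does on `S` and `T`, namely by `S ↦ S ^ 3` and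
`T ↦ T * S * T`. This extends `τ₁`, and conjugation by `P`, then `ψ` and conjugation by `Z`, extends
`τ` and `ρ`.

The extension `ρ` takes values in `DR₀` once `Z` and its inverse are polynomially bounded and `P`
and its inverse are exponentially bounded, since `ψ` turns exponential growth into polynomial
growth. Let `U` be `P` or `Z`, with `f i = i + 1`, `A = J̃ - 1` or `f i = i * 2`, `A = D - 1`: row
`f i` of `U` is row `i` times `A`, and row `i` of `A` starts with an entry `1` in column `f i`.
Hence `U * A * U⁻¹` is the shift matrix whose row `i` is the unit vector at `f i`, and comparing the
entries of `A * U⁻¹` with those of `U⁻¹` gives a recursion in which a bound of product form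
`α j * w i` propagates.

The matrices `τ₁(Y)` with `Y` in `SL(2, ℤ)`, `P` and `Z` are integral with integral inverses,
whereas the coefficient of `t ^ 3` in an entry of `W(t)` is `-11 / 2`, so the coset of determinant
`-1` contains no integer matrix.
-/

open PowerSeries

/-! ### Power series with exponentially bounded coefficients -/

section ExpBounded

variable {R : Type*} [NormedCommRing R] [NormOneClass R]

variable (R) in
/-- The subring of power series whose coefficients grow at most exponentially. The exponent `n + 1`
lets one constant also absorb the constant coefficient. -/
def expBounded : Subring R⟦X⟧ where
  carrier := {a | ∃ K : ℝ, 1 ≤ K ∧ ∀ n, ‖coeff n a‖ ≤ K ^ (n + 1)}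
  mul_mem' := by
    rintro a b ⟨K, hK, ha⟩ ⟨L, hL, hb⟩
    refine ⟨2 * K * L, by nlinarith, fun n => ?_⟩
    have hterm : ∀ p ∈ Finset.HasAntidiagonal.antidiagonal n,
        ‖coeff p.1 a * coeff p.2 b‖ ≤ K ^ (n + 1) * L ^ (n + 1) := by
      intro p hp
      have hp := Finset.HasAntidiagonal.mem_antidiagonal.mp hp
      have hK' : K ^ (p.1 + 1) ≤ K ^ (n + 1) := pow_le_pow_right₀ hK (by omega)
      have hL' : L ^ (p.2 + 1) ≤ L ^ (n + 1) := pow_le_pow_right₀ hL (by omega)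
      exact (norm_mul_le _ _).trans
        (mul_le_mul ((ha _).trans hK') ((hb _).trans hL') (norm_nonneg _) (by positivity))
    have hcard : ((n + 1 : ℕ) : ℝ) ≤ 2 ^ (n + 1) := mod_cast Nat.lt_two_pow_self.le
    calc ‖coeff n (a * b)‖ ≤ (n + 1 : ℕ) * (K ^ (n + 1) * L ^ (n + 1)) := by
          rw [coeff_mul, ← nsmul_eq_mul]
          refine (norm_sum_le_of_le _ hterm).trans_eq ?_
          rw [Finset.sum_const, Finset.Nat.card_antidiagonal]
      _ ≤ 2 ^ (n + 1) * (K ^ (n + 1) * L ^ (n + 1)) := by gcongr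
      _ = (2 * K * L) ^ (n + 1) := by ring
  one_mem' := ⟨1, le_rfl, fun n => by rw [coeff_one]; split_ifs <;> simp⟩
  add_mem' := by
    rintro a b ⟨K, hK, ha⟩ ⟨L, hL, hb⟩
    refine ⟨K + L, by linarith, fun n => ?_⟩
    rw [map_add]
    exact (norm_add_le_of_le (ha n) (hb n)).trans
      (pow_add_pow_le (by linarith) (by linarith) n.succ_ne_zero)
  zero_mem' := ⟨1, le_rfl, fun n => by simp⟩
  neg_mem' := by
    rintro a ⟨K, hK, ha⟩
    exact ⟨K, hK, fun n => by rw [map_neg, norm_neg]; exact ha n⟩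

theorem X_mem_expBounded : (X : R⟦X⟧) ∈ expBounded R :=
  ⟨1, le_rfl, fun n => by rw [coeff_X]; split_ifs <;> simp⟩

theorem rescale_mem_expBounded {a : R⟦X⟧} (ha : a ∈ expBounded R) (c : R) :
    rescale c a ∈ expBounded R := by
  obtain ⟨K, hK, ha⟩ := ha
  have hc : 1 ≤ max 1 ‖c‖ := le_max_left _ _
  refine ⟨max 1 ‖c‖ * K, one_le_mul_of_one_le_of_one_le hc hK, fun n => ?_⟩
  rw [coeff_rescale, mul_pow]
  refine (norm_mul_le _ _).trans (mul_le_mul ?_ (ha n) (norm_nonneg _) (by positivity))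
  calc ‖c ^ n‖ ≤ ‖c‖ ^ n := norm_pow_le c n
    _ ≤ max 1 ‖c‖ ^ n := by gcongr; exact le_max_right _ _
    _ ≤ max 1 ‖c‖ ^ (n + 1) := by gcongr; exact n.le_succ

theorem derivative_mem_expBounded {a : R⟦X⟧} (ha : a ∈ expBounded R) :
    derivative R a ∈ expBounded R := by
  obtain ⟨K, hK, ha⟩ := ha
  refine ⟨2 * K ^ 2, by nlinarith, fun n => ?_⟩
  have hcast : ‖(n + 1 : R)‖ ≤ 2 ^ (n + 1) := by
    have := Nat.norm_cast_le (α := R) (n + 1)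
    rw [norm_one, mul_one, Nat.cast_succ] at this
    exact this.trans (mod_cast Nat.lt_two_pow_self.le)
  calc ‖coeff n (derivative R a)‖ ≤ K ^ (n + 1 + 1) * 2 ^ (n + 1) := by
        rw [coeff_derivative]
        exact (norm_mul_le _ _).trans (by gcongr; exact ha _)
    _ ≤ K ^ (2 * (n + 1)) * 2 ^ (n + 1) := by gcongr; omega
    _ = (2 * K ^ 2) ^ (n + 1) := by ring

theorem exists_common_bound_of_mem_expBounded {ι : Type*} [Finite ι] {a : ι → R⟦X⟧}
    (ha : ∀ i, a i ∈ expBounded R) : ∃ K : ℝ, 1 ≤ K ∧ ∀ i n, ‖coeff n (a i)‖ ≤ K ^ (n + 1) := by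
  choose K hK ha using ha
  obtain ⟨M, hM⟩ := Finite.exists_le K
  refine ⟨max 1 M, le_max_left _ _, fun i n => (ha i n).trans ?_⟩
  have := hK i
  gcongr
  exact (hM i).trans (le_max_right _ _)

end ExpBounded

/-! ### The series `g` and the matrix `W(t)` -/

theorem coeff_succ_gSeries (n : ℕ) : coeff (n + 1) gSeries = (-1) ^ n * catalan n := by
  simp [gSeries, bSeq, coeff_one]

theorem catalan_le_four_pow (n : ℕ) : catalan n ≤ 4 ^ n := by
  rw [catalan_eq_centralBinom_div, Nat.centralBinom, show 4 = 2 ^ 2 from rfl, ← pow_mul]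
  exact (Nat.div_le_self _ _).trans (Nat.choose_le_two_pow _ _)

theorem gSeries_mem_expBounded : gSeries ∈ expBounded ℂ := by
  refine ⟨4, by norm_num, fun n => ?_⟩
  obtain _ | n := n
  · simp [constantCoeff_gSeries]
  · calc ‖coeff (n + 1) gSeries‖ = catalan n := by simp [coeff_succ_gSeries]
      _ ≤ 4 ^ n := mod_cast catalan_le_four_pow n
      _ ≤ 4 ^ (n + 1 + 1) := by gcongr <;> norm_num; omega

theorem derivative_gSeries_mul : derivative ℂ gSeries * (2 * gSeries + 1) = 1 := by
  have h := congrArg (derivative ℂ) gSeries_sq_add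
  rw [map_add, Derivation.leibniz_pow, derivative_X] at h
  simp only [nsmul_eq_mul, smul_eq_mul] at h
  linear_combination h

theorem derivative_gSeries_sq_mul : derivative ℂ gSeries ^ 2 * (4 * X + 1) = 1 := by
  linear_combination (derivative ℂ gSeries * (2 * gSeries + 1) + 1) * derivative_gSeries_mul -
    4 * derivative ℂ gSeries ^ 2 * gSeries_sq_add

theorem coeff_derivative_gSeries (n : ℕ) :
    coeff n (derivative ℂ gSeries) = (-1) ^ n * Nat.centralBinom n := by
  rw [coeff_derivative, coeff_succ_gSeries, ← succ_mul_catalan_eq_centralBinom]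
  push_cast
  ring

/-- As `g' = 1 / √(1 + 4t)`, a factorization `t ^ 2 + 4 t + 1 = (1 + 4 a t) (1 + 4 b t)` splits
`1 / √(t ^ 2 + 4 t + 1)` accordingly. -/
theorem invSqrt_eq_rescale_mul_rescale {a b : ℂ} (hadd : a + b = 1) (hmul : 16 * (a * b) = 1) :
    invSqrt = rescale a (derivative ℂ gSeries) * rescale b (derivative ℂ gSeries) := by
  set r := rescale a (derivative ℂ gSeries) * rescale b (derivative ℂ gSeries) with hr
  have hrescale : ∀ c : ℂ,
      rescale c (derivative ℂ gSeries) ^ 2 * (4 * (C c * X) + 1) = 1 := fun c => by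
    simpa [map_ofNat] using congrArg (rescale c) derivative_gSeries_sq_mul
  have hfactor : (X ^ 2 + 4 * X + 1 : ℂ⟦X⟧) = (4 * (C a * X) + 1) * (4 * (C b * X) + 1) := by
    have hadd' : (C a + C b : ℂ⟦X⟧) = 1 := by rw [← map_add, hadd, map_one]
    have hmul' : (16 * (C a * C b) : ℂ⟦X⟧) = 1 := by
      rw [← map_mul, ← map_ofNat C 16, ← map_mul, hmul, map_one]
    linear_combination -4 * X * hadd' - X ^ 2 * hmul'
  have hsq : invSqrt ^ 2 = r ^ 2 := by
    have hrsq : r ^ 2 * (X ^ 2 + 4 * X + 1) = 1 := by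
      rw [hfactor, hr, mul_pow, mul_mul_mul_comm, hrescale, hrescale, one_mul]
    linear_combination invSqrt ^ 2 * -hrsq + r ^ 2 * invSqrt_spec.1
  have hr0 : constantCoeff r = 1 := by
    simp [hr, ← coeff_zero_eq_constantCoeff_apply, coeff_mul, coeff_derivative_gSeries]
  refine (sq_eq_sq_iff_eq_or_eq_neg.mp hsq).resolve_right fun hneg => ?_
  have := congrArg constantCoeff hneg
  rw [invSqrt_spec.2, map_neg, hr0] at this
  norm_num at this

theorem exists_add_eq_one_and_mul_eq : ∃ a b : ℂ, a + b = 1 ∧ 16 * (a * b) = 1 := by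
  refine ⟨(2 + √3) / 4, (2 - √3) / 4, by ring, ?_⟩
  have h : ((√3 : ℝ) : ℂ) ^ 2 = 3 := mod_cast Real.sq_sqrt (by norm_num : (0 : ℝ) ≤ 3)
  linear_combination -h

theorem invSqrt_mem_expBounded : invSqrt ∈ expBounded ℂ := by
  obtain ⟨a, b, hadd, hmul⟩ := exists_add_eq_one_and_mul_eq
  have hg := derivative_mem_expBounded gSeries_mem_expBounded
  rw [invSqrt_eq_rescale_mul_rescale hadd hmul]
  exact mul_mem (rescale_mem_expBounded hg a) (rescale_mem_expBounded hg b)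

theorem coeff_two_invSqrt : coeff 2 invSqrt = 11 / 2 := by
  obtain ⟨a, b, hadd, hmul⟩ := exists_add_eq_one_and_mul_eq
  rw [invSqrt_eq_rescale_mul_rescale hadd hmul, coeff_mul,
    Finset.Nat.sum_antidiagonal_eq_sum_range_succ_mk]
  simp only [Finset.sum_range_succ, Finset.sum_range_zero, coeff_rescale, coeff_derivative_gSeries]
  norm_num [Nat.centralBinom, Nat.choose]
  linear_combination 6 * (a + b + 1) * hadd - 1 / 2 * hmul

theorem Wt_mem_expBounded (i j : Fin 2) : Wt i j ∈ expBounded ℂ := by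
  have hX : X ∈ expBounded ℂ := X_mem_expBounded
  have hg : 2 * gSeries + 1 ∈ expBounded ℂ :=
    add_mem (mul_mem (natCast_mem _ 2) gSeries_mem_expBounded) (one_mem _)
  rw [Wt, Matrix.smul_apply, smul_eq_mul]
  refine mul_mem invSqrt_mem_expBounded ?_
  fin_cases i <;> fin_cases j <;> simp [hg, hX]

theorem Wt_mul_self : Wt * Wt = 1 := by
  rw [Wt, Matrix.smul_mul, Matrix.mul_smul, smul_smul, Matrix.mul_fin_two, Matrix.one_fin_two]
  ext i j : 1
  fin_cases i <;> fin_cases j <;>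
    simp only [Matrix.smul_apply, smul_eq_mul, Fin.zero_eta, Fin.mk_one, Matrix.of_apply,
      Matrix.cons_val', Matrix.cons_val_zero, Matrix.cons_val_one, Matrix.cons_val_fin_one]
  · linear_combination invSqrt_spec.1 + 4 * invSqrt ^ 2 * gSeries_sq_add
  · ring
  · ring
  · linear_combination invSqrt_spec.1 + 4 * invSqrt ^ 2 * gSeries_sq_add

theorem map_constantCoeff_Wt : Wt.map constantCoeff = !![0, 1; 1, 0] := by
  ext i j
  fin_cases i <;> fin_cases j <;> simp [Wt, invSqrt_spec.2, constantCoeff_gSeries]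

theorem exists_norm_coeff_Wt_le : ∃ C : ℝ, ∀ (i j : Fin 2) (n : ℕ),
    ‖coeff n (Wt i j)‖ ≤ (2 : ℝ) ^ (C * (n : ℝ)) := by
  obtain ⟨K, hK, hb⟩ := exists_common_bound_of_mem_expBounded
    (a := fun p : Fin 2 × Fin 2 => Wt p.1 p.2) fun p => Wt_mem_expBounded p.1 p.2
  refine ⟨Real.logb 2 (K ^ 2), fun i j n => ?_⟩
  rw [Real.rpow_mul two_pos.le, Real.rpow_logb two_pos (by norm_num) (by positivity),
    Real.rpow_natCast]
  rcases eq_or_ne n 0 with rfl | hn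
  · have h := congrFun₂ map_constantCoeff_Wt i j
    rw [Matrix.map_apply] at h
    rw [coeff_zero_eq_constantCoeff_apply, h]
    fin_cases i <;> fin_cases j <;> simp
  · refine (hb (i, j) n).trans ?_
    rw [← pow_mul]
    exact pow_le_pow_right₀ hK (by omega)

theorem St_mul_Wt : St.1 * Wt = Wt * (St ^ 3).1 := by
  have h : (St ^ 3).1 = -St.1 := by
    rw [pow_succ, St_sq, neg_one_mul]; rfl
  rw [h]
  ext i j : 1
  fin_cases i <;> fin_cases j <;> simp [Wt, St, Matrix.mul_apply, Fin.sum_univ_two]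

theorem Jt_mul_St_mul_Jt : (Jt * St * Jt).1 = !![1, gSeries; 1 + gSeries, 1 + X] := by
  rw [Matrix.SpecialLinearGroup.coe_mul, Matrix.SpecialLinearGroup.coe_mul]
  simp only [Jt, St, Matrix.mul_fin_two]
  ext i j : 1
  fin_cases i <;> fin_cases j <;>
    simp only [Fin.zero_eta, Fin.mk_one, Matrix.of_apply, Matrix.cons_val', Matrix.cons_val_zero,
      Matrix.cons_val_one, Matrix.cons_val_fin_one]
  · ring
  · linear_combination gSeries_sq_add
  · linear_combination -gSeries_sq_add
  · ring

theorem Jt_mul_Wt : Jt.1 * Wt = Wt * (Jt * St * Jt).1 := by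
  rw [Jt_mul_St_mul_Jt, Wt, Matrix.mul_smul, Matrix.smul_mul]
  simp only [Jt, Matrix.mul_fin_two]
  congr! 4 <;> ring_nf

/-! ### Column-finite matrices by rows -/

theorem bounded_downward_induction {α : Type*} [Preorder α] [LocallyFiniteOrder α] {p : α → Prop}
    (N : α) (h : ∀ i, (∀ m ∈ Finset.Ioc i N, p m) → p i) (i : α) : p i := by
  induction hs : Finset.Ioc i N using Finset.strongInduction generalizing i with
  | _ s ih =>
    subst hs
    refine h i fun m hm => ih _ ?_ m rfl
    have him := Finset.mem_Ioc.mp hm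
    exact (Finset.ssubset_iff_of_subset (Finset.Ioc_subset_Ioc_left him.1.le)).mpr
      ⟨m, hm, Finset.left_notMem_Ioc⟩

theorem exists_le_of_entry_ne_zero (A : ColFin) (j : ℕ+) :
    ∃ N, ∀ m, entry A m j ≠ 0 → m ≤ N := by
  obtain ⟨N, hN⟩ := (A (Finsupp.single j 1)).support.bddAbove
  exact ⟨N, fun m hm => hN (Finsupp.mem_support_iff.mpr hm)⟩

theorem entry_mul_congr_row {A B : ColFin} {i k : ℕ+} (h : ∀ m, entry A i m = entry B k m)
    (C : ColFin) (j : ℕ+) : entry (A * C) i j = entry (B * C) k j := by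
  obtain ⟨N, hN⟩ := exists_le_of_entry_ne_zero C j
  have hs : ∀ m, entry C m j ≠ 0 → m ∈ Finset.Iic N := fun m hm => Finset.mem_Iic.mpr (hN m hm)
  rw [entry_mul A C i j hs, entry_mul B C k j hs]
  simp only [h]

theorem entry_mul_of_leading_one {A B : ColFin} {i j n N : ℕ+}
    (hzero : ∀ m < n, entry A i m = 0) (hone : entry A i n = 1)
    (hN : ∀ m, entry B m j ≠ 0 → m ≤ N) :
    entry (A * B) i j = entry B n j + ∑ m ∈ Finset.Ioc n N, entry A i m * entry B m j := by
  have hs : ∀ m, entry B m j ≠ 0 → m ∈ insert n (Finset.Iic N) := fun m hm =>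
    Finset.mem_insert_of_mem (Finset.mem_Iic.mpr (hN m hm))
  have hsub : insert n (Finset.Ioc n N) ⊆ insert n (Finset.Iic N) :=
    Finset.insert_subset_insert _ fun m hm => Finset.mem_Iic.mpr (Finset.mem_Ioc.mp hm).2
  rw [entry_mul A B i j hs, ← Finset.sum_subset hsub, Finset.sum_insert Finset.left_notMem_Ioc,
    hone, one_mul]
  intro m hm hm'
  simp only [Finset.mem_insert, Finset.mem_Iic, Finset.mem_Ioc, not_or, not_and] at hm hm'
  have hmn : m < n := lt_of_le_of_ne
    (not_lt.mp fun hnm => hm'.2 hnm (hm.resolve_left hm'.1)) hm'.1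
  rw [hzero m hmn, zero_mul]

/-! ### Upper unitriangular units -/

theorem entry_unitOfUpper (a : ℕ+ → ℕ+ → ℂ) (h : IsUpperUnitriangular a) (i j : ℕ+) :
    entry (unitOfUpper a h) i j = a i j := by
  rw [unitOfUpper, IsUnit.unit_spec, entry_ofMatrix]

section UpperUnitriangular

variable {U : ColFinˣ} (hU : IsUpperUnitriangular (entry U))
include hU

theorem IsUpperUnitriangular.entry_inv_eq {j N : ℕ+}
    (hN : ∀ m, entry (U⁻¹ : ColFinˣ) m j ≠ 0 → m ≤ N) (i : ℕ+) :
    entry (U⁻¹ : ColFinˣ) i j = (if i = j then 1 else 0) -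
      ∑ m ∈ Finset.Ioc i N, entry U i m * entry (U⁻¹ : ColFinˣ) m j := by
  rw [eq_sub_iff_add_eq, ← entry_mul_of_leading_one (hU.1 i) (hU.2 i) hN, Units.mul_inv, entry_one]

theorem IsUpperUnitriangular.inv : IsUpperUnitriangular (entry (U⁻¹ : ColFinˣ)) := by
  have hkey : ∀ j i, j ≤ i → entry (U⁻¹ : ColFinˣ) i j = if i = j then 1 else 0 := by
    intro j i
    obtain ⟨N, hN⟩ := exists_le_of_entry_ne_zero (U⁻¹ : ColFinˣ) j
    induction i using bounded_downward_induction N with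
    | h i ih =>
      intro hji
      rw [hU.entry_inv_eq hN i, Finset.sum_eq_zero, sub_zero]
      intro m hm
      have hjm : j < m := hji.trans_lt (Finset.mem_Ioc.mp hm).1
      rw [ih m hm hjm.le, if_neg hjm.ne', mul_zero]
  exact ⟨fun i j hji => by rw [hkey j i hji.le, if_neg hji.ne'],
    fun i => by rw [hkey i i le_rfl, if_pos rfl]⟩

end UpperUnitriangular

/-! ### Matrices over a subring -/

/-- The column-finite matrices with all entries in the subring `R`. -/
def matricesOver (R : Subring ℂ) : Subring ColFin where
  carrier := {A | ∀ i j, entry A i j ∈ R}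
  mul_mem' := by
    intro A B hA hB i j
    obtain ⟨N, hN⟩ := exists_le_of_entry_ne_zero B j
    rw [entry_mul A B i j fun m hm => Finset.mem_Iic.mpr (hN m hm)]
    exact R.sum_mem fun m _ => R.mul_mem (hA i m) (hB m j)
  one_mem' i j := by
    rw [entry_one]
    split_ifs
    exacts [R.one_mem, R.zero_mem]
  add_mem' hA hB i j := R.add_mem (hA i j) (hB i j)
  zero_mem' _ _ := R.zero_mem
  neg_mem' hA i j := R.neg_mem (hA i j)

theorem isIntegerMatrix_iff_mem_matricesOver {A : ColFin} :
    IsIntegerMatrix A ↔ A ∈ matricesOver (Int.castRingHom ℂ).range :=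
  forall₂_congr fun _ _ => exists_congr fun _ => eq_comm

theorem IsUpperUnitriangular.inv_mem_matricesOver {R : Subring ℂ} {U : ColFinˣ}
    (hU : IsUpperUnitriangular (entry U)) (hR : (U : ColFin) ∈ matricesOver R) :
    ((U⁻¹ : ColFinˣ) : ColFin) ∈ matricesOver R := by
  intro i j
  obtain ⟨N, hN⟩ := exists_le_of_entry_ne_zero (U⁻¹ : ColFinˣ) j
  induction i using bounded_downward_induction N with
  | h i ih =>
    rw [hU.entry_inv_eq hN i]
    refine R.sub_mem ?_ (R.sum_mem fun m hm => R.mul_mem (hR i m) (ih m hm))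
    split_ifs
    exacts [R.one_mem, R.zero_mem]

/-- The power series with all coefficients in the subring `R`. -/
def seriesOver {S : Type*} [CommRing S] (R : Subring S) : Subring S⟦X⟧ where
  carrier := {a | ∀ n, coeff n a ∈ R}
  mul_mem' ha hb n := by
    rw [coeff_mul]
    exact R.sum_mem fun p _ => R.mul_mem (ha p.1) (hb p.2)
  one_mem' n := by
    rw [coeff_one]
    split_ifs
    exacts [R.one_mem, R.zero_mem]
  add_mem' ha hb n := R.add_mem (ha n) (hb n)
  zero_mem' _ := R.zero_mem
  neg_mem' ha n := R.neg_mem (ha n)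

theorem entry_gammaInv (X : Matrix (Fin 2) (Fin 2) ℂ⟦X⟧) (i j : ℕ+) :
    entry (gammaInv X) i j = blockEntry X i j :=
  entry_ofMatrix _ (blockEntry_finite X) i j

theorem gammaInv_mem_matricesOver {R : Subring ℂ} {X : Matrix (Fin 2) (Fin 2) ℂ⟦X⟧}
    (hX : ∀ a b, X a b ∈ seriesOver R) : gammaInv X ∈ matricesOver R := by
  intro i j
  rw [entry_gammaInv, blockEntry]
  split_ifs
  exacts [hX _ _ _, R.zero_mem]

theorem entry_psi (A : ColFin) (i j : ℕ+) : entry (psi A) i j = psiEntry A i j :=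
  entry_ofMatrix _ (psiEntry_finite A) i j

theorem mem_matricesOver_of_psi_mem {R : Subring ℂ} {A : ColFin} (h : psi A ∈ matricesOver R) :
    A ∈ matricesOver R := by
  intro i j
  obtain ⟨k, hk, hki⟩ := exists_oddPart_v2 1 i.natPred
  obtain ⟨l, hl, hlj⟩ := exists_oddPart_v2 1 j.natPred
  have hkl := h k l
  rwa [entry_psi, psiEntry, if_pos (hk.trans hl.symm), hki, hlj, PNat.succPNat_natPred,
    PNat.succPNat_natPred] at hkl

/-! ### Krylov matrices -/

/-- Row `i` of `A` starts with an entry `1` in column `f i`. -/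
structure IsEchelon (f : ℕ+ → ℕ+) (A : ColFin) : Prop where
  entry_of_lt : ∀ i m, m < f i → entry A i m = 0
  entry_self : ∀ i, entry A i (f i) = 1

/-- The rows of `U` are rows of powers of `A`: those outside the range of `f` are rows of the
identity, and row `f i` is obtained by multiplying row `i` by `A` on the right. Both `P` and `Z` are
of this form, with `f i = i + 1` and `f i = i * 2`, respectively. -/
structure IsKrylov (f : ℕ+ → ℕ+) (A U : ColFin) : Prop where
  entry_of_notMem_range : ∀ i ∉ Set.range f, ∀ j, entry U i j = if i = j then 1 else 0
  entry_apply : ∀ i j, entry U (f i) j = entry (U * A) i j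

section Krylov

variable {f : ℕ+ → ℕ+} {A : ColFin}

theorem IsKrylov.of_pow {U : ColFin} {d : ℕ+ → ℕ+} {k : ℕ+ → ℕ}
    (hU : ∀ i j, entry U i j = entry (A ^ k i) (d i) j) (hdf : ∀ i, d (f i) = d i)
    (hkf : ∀ i, k (f i) = k i + 1) (hd : ∀ i ∉ Set.range f, d i = i)
    (hk : ∀ i ∉ Set.range f, k i = 0) : IsKrylov f A U where
  entry_of_notMem_range i hi j := by rw [hU, hk i hi, hd i hi, pow_zero, entry_one]
  entry_apply i j := by rw [entry_mul_congr_row (hU i) A j, hU, hdf, hkf, pow_succ]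

theorem IsKrylov.norm_entry_le {U : ColFin} (hK : IsKrylov f A U)
    (hf : ∀ i, i < f i) {φ : ℕ+ → ℝ} (hφ : ∀ j, 1 ≤ φ j)
    (hupper : ∀ i j, j ≤ i → entry A i j = 0)
    (hsum : ∀ j, ∑ m ∈ Finset.Ico 1 j, φ m * ‖entry A m j‖ ≤ φ j) (i j : ℕ+) :
    ‖entry U i j‖ ≤ φ j := by
  induction i using PNat.strongInductionOn generalizing j with
  | _ i ih =>
    by_cases hi : i ∈ Set.range f
    · obtain ⟨i, rfl⟩ := hi
      have hcol : ∀ m, entry A m j ≠ 0 → m ∈ Finset.Ico 1 j := fun m hm =>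
        Finset.mem_Ico.mpr ⟨one_le, not_le.mp fun hjm => hm (hupper m j hjm)⟩
      rw [hK.entry_apply, entry_mul U A i j hcol]
      refine (norm_sum_le_of_le _ fun m _ => ?_).trans (hsum j)
      rw [norm_mul]
      gcongr
      exact ih i (hf i) m
    · rw [hK.entry_of_notMem_range i hi]
      split_ifs
      · simpa using hφ j
      · simpa using zero_le_one.trans (hφ j)

variable {U : ColFinˣ} (hK : IsKrylov f A U)
include hK

theorem IsKrylov.entry_inv_of_notMem_range {i : ℕ+} (hi : i ∉ Set.range f) (j : ℕ+) :
    entry (U⁻¹ : ColFinˣ) i j = if i = j then 1 else 0 := by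
  have hrow := fun j => (hK.entry_of_notMem_range i hi j).trans (entry_one i j).symm
  have hmul := entry_mul_congr_row hrow (U⁻¹ : ColFinˣ) j
  rw [Units.mul_inv, one_mul, entry_one] at hmul
  exact hmul.symm

theorem IsKrylov.entry_conj (i j : ℕ+) :
    entry (U * A * (U⁻¹ : ColFinˣ)) i j = if f i = j then 1 else 0 := by
  rw [entry_mul_congr_row fun m => (hK.entry_apply i m).symm, Units.mul_inv, entry_one]

theorem IsKrylov.entry_mul_inv_apply (hf : f.Injective) (i j : ℕ+) :
    entry (A * (U⁻¹ : ColFinˣ)) i (f j) = entry (U⁻¹ : ColFinˣ) i j := by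
  have hcol : ∀ m, entry (U * A * (U⁻¹ : ColFinˣ)) m (f j) ≠ 0 → m ∈ ({j} : Finset ℕ+) := by
    intro m hm
    rw [hK.entry_conj] at hm
    exact Finset.mem_singleton.mpr (hf (of_not_not fun h => hm (if_neg h)))
  rw [← U.inv_mul_cancel_left (A * (U⁻¹ : ColFinˣ)), ← mul_assoc (U : ColFin),
    entry_mul _ _ i (f j) hcol, Finset.sum_singleton, hK.entry_conj, if_pos rfl, mul_one]

theorem IsKrylov.entry_mul_inv_of_notMem_range (i : ℕ+) {j : ℕ+} (hj : j ∉ Set.range f) :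
    entry (A * (U⁻¹ : ColFinˣ)) i j = 0 := by
  have hcol : ∀ m, entry (U * A * (U⁻¹ : ColFinˣ)) m j ≠ 0 → m ∈ (∅ : Finset ℕ+) := by
    intro m hm
    rw [hK.entry_conj] at hm
    exact absurd ⟨m, of_not_not fun h => hm (if_neg h)⟩ hj
  rw [← U.inv_mul_cancel_left (A * (U⁻¹ : ColFinˣ)), ← mul_assoc (U : ColFin),
    entry_mul _ _ i j hcol, Finset.sum_empty]

/-- Expanding `A * U⁻¹` by the echelon form of `A` expresses row `f i` of `U⁻¹` by the rows below it
and, in the column `f j`, by the entry `(i, j)`. -/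
theorem IsKrylov.norm_entry_inv_le (hA : IsEchelon f A) (hf : f.Injective)
    (hlt : ∀ j, j < f j) {q : ℝ} {α w : ℕ+ → ℝ} (hw : ∀ i, 0 ≤ w i) (hα : ∀ j, 0 ≤ α j) (hq : 0 ≤ q)
    (hdiag : ∀ j, 1 ≤ α j * w j) (hα_le : ∀ j, α j ≤ q * α (f j))
    (hsum : ∀ i N, q * w i + ∑ m ∈ Finset.Ioc (f i) N, ‖entry A i m‖ * w m ≤ w (f i))
    (i j : ℕ+) : ‖entry (U⁻¹ : ColFinˣ) i j‖ ≤ α j * w i := by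
  induction j using PNat.strongInductionOn generalizing i with
  | _ j ihj =>
  have hAinv : ∀ i, ‖entry (A * (U⁻¹ : ColFinˣ)) i j‖ ≤ α j * (q * w i) := by
    intro i
    by_cases hj : j ∈ Set.range f
    · obtain ⟨j, rfl⟩ := hj
      rw [hK.entry_mul_inv_apply hf]
      calc ‖entry (U⁻¹ : ColFinˣ) i j‖ ≤ α j * w i := ihj j (hlt j) i
        _ ≤ q * α (f j) * w i := mul_le_mul_of_nonneg_right (hα_le j) (hw i)
        _ = α (f j) * (q * w i) := by ring
    · rw [hK.entry_mul_inv_of_notMem_range i hj, norm_zero]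
      exact mul_nonneg (hα j) (mul_nonneg hq (hw i))
  obtain ⟨N, hN⟩ := exists_le_of_entry_ne_zero (U⁻¹ : ColFinˣ) j
  induction i using bounded_downward_induction N with
  | h i ih =>
  by_cases hi : i ∈ Set.range f
  · obtain ⟨i, rfl⟩ := hi
    rw [eq_sub_of_add_eq (entry_mul_of_leading_one (hA.entry_of_lt i) (hA.entry_self i) hN).symm]
    have hterm : ∀ m ∈ Finset.Ioc (f i) N, ‖entry A i m * entry (U⁻¹ : ColFinˣ) m j‖ ≤
        α j * (‖entry A i m‖ * w m) := by
      intro m hm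
      rw [norm_mul, mul_left_comm]
      exact mul_le_mul_of_nonneg_left (ih m hm) (norm_nonneg _)
    calc _ ≤ α j * (q * w i) + ∑ m ∈ Finset.Ioc (f i) N, α j * (‖entry A i m‖ * w m) :=
          norm_sub_le_of_le (hAinv i) (norm_sum_le_of_le _ hterm)
      _ = α j * (q * w i + ∑ m ∈ Finset.Ioc (f i) N, ‖entry A i m‖ * w m) := by
          rw [mul_add, Finset.mul_sum]
      _ ≤ α j * w (f i) := mul_le_mul_of_nonneg_left (hsum i N) (hα j)
  · rw [hK.entry_inv_of_notMem_range hi]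
    split_ifs with hij
    · rw [norm_one, hij]
      exact hdiag j
    · rw [norm_zero]
      exact mul_nonneg (hα j) (hw i)

end Krylov

/-! ### The matrix `P` -/

theorem sum_Ico_pnat (a b : ℕ+) (F : ℕ → ℝ) :
    ∑ m ∈ Finset.Ico a b, F m = ∑ m ∈ Finset.Ico (a : ℕ) b, F m := by
  rw [← PNat.map_subtype_embedding_Ico]
  exact (Finset.sum_map (Finset.Ico a b) (Function.Embedding.subtype _) F).symm

theorem sum_Ioc_pnat (a b : ℕ+) (F : ℕ → ℝ) :
    ∑ m ∈ Finset.Ioc a b, F m = ∑ m ∈ Finset.Ioc (a : ℕ) b, F m := by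
  rw [← PNat.map_subtype_embedding_Ioc]
  exact (Finset.sum_map (Finset.Ioc a b) (Function.Embedding.subtype _) F).symm

section SuccKrylov

variable {A : ColFin} {M : ℝ} (hM : 1 ≤ M)
  (hAM : ∀ i j, i < j → ‖entry A i j‖ ≤ M ^ ((j : ℕ) - i))
include hM hAM

/-- With the weights `w i = μ⁻¹ ^ i`, where `μ = M * (1 + 2 * M)`, the tail of row `i` of `A` is
dominated by a geometric series of ratio `x = M / μ`, and `M⁻¹ ^ i * x ^ (i + 2) / (1 - x)` is half
of `w (i + 1)`. -/
theorem sum_Ioc_norm_entry_mul_le (i N : ℕ+) :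
    ∑ m ∈ Finset.Ioc (i + 1) N, ‖entry A i m‖ * (M * (1 + 2 * M))⁻¹ ^ (m : ℕ) ≤
      (M * (1 + 2 * M))⁻¹ ^ ((i : ℕ) + 1) / 2 := by
  set x := (1 + 2 * M)⁻¹ with hx
  have hx0 : 0 < x := by positivity
  have hx1 : x < 1 := inv_lt_one_of_one_lt₀ (by linarith)
  have hterm : ∀ m ∈ Finset.Ioc (i + 1) N,
      ‖entry A i m‖ * (M * (1 + 2 * M))⁻¹ ^ (m : ℕ) ≤ (M ^ (i : ℕ))⁻¹ * x ^ (m : ℕ) := by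
    intro m hm
    have him : i < m := (PNat.lt_add_right i 1).trans (Finset.mem_Ioc.mp hm).1
    calc _ ≤ M ^ ((m : ℕ) - i) * (M * (1 + 2 * M))⁻¹ ^ (m : ℕ) := by
          gcongr
          exact hAM i m him
      _ = (M ^ (i : ℕ))⁻¹ * x ^ (m : ℕ) := by
          rw [pow_sub₀ M (by positivity) (PNat.coe_le_coe _ _ |>.mpr him.le), mul_inv, mul_pow,
            ← hx, inv_pow M]
          field_simp
  have hgeom : ∑ m ∈ Finset.Ioc ((i : ℕ) + 1) N, x ^ m ≤ x ^ ((i : ℕ) + 2) / (1 - x) := by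
    rw [← Finset.Ico_add_one_add_one_eq_Ioc]
    exact geom_sum_Ico_le_of_lt_one hx0.le hx1
  calc _ ≤ ∑ m ∈ Finset.Ioc (i + 1) N, (M ^ (i : ℕ))⁻¹ * x ^ (m : ℕ) := Finset.sum_le_sum hterm
    _ = (M ^ (i : ℕ))⁻¹ * ∑ m ∈ Finset.Ioc ((i : ℕ) + 1) N, x ^ m := by
        rw [Finset.mul_sum]
        exact sum_Ioc_pnat (i + 1) N fun m => (M ^ (i : ℕ))⁻¹ * x ^ m
    _ ≤ (M ^ (i : ℕ))⁻¹ * (x ^ ((i : ℕ) + 2) / (1 - x)) := by gcongr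
    _ = (M * (1 + 2 * M))⁻¹ ^ ((i : ℕ) + 1) / 2 := by
        have hx2 : 1 - x = 2 * M * x := by rw [hx]; field_simp; ring
        rw [mul_inv, ← hx, hx2, mul_pow, inv_pow M]
        field_simp
        ring

variable (hA : IsEchelon (· + 1) A)
include hA

theorem IsKrylov.norm_entry_le_two_mul_pow {U : ColFin} (hK : IsKrylov (· + 1) A U) (i j : ℕ+) :
    ‖entry U i j‖ ≤ (2 * M) ^ (j : ℕ) := by
  refine hK.norm_entry_le (fun i => PNat.lt_add_right i 1) (φ := fun j => (2 * M) ^ (j : ℕ))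
    (fun j => one_le_pow₀ (by linarith))
    (fun i j hji => hA.entry_of_lt i j (PNat.lt_add_one_iff.mpr hji)) (fun j => ?_) i j
  have hterm : ∀ m ∈ Finset.Ico 1 j,
      (2 * M) ^ (m : ℕ) * ‖entry A m j‖ ≤ 2 ^ (m : ℕ) * M ^ (j : ℕ) := by
    intro m hm
    have hmj := (Finset.mem_Ico.mp hm).2
    calc (2 * M) ^ (m : ℕ) * ‖entry A m j‖ ≤ (2 * M) ^ (m : ℕ) * M ^ ((j : ℕ) - m) := by
          gcongr
          exact hAM m j hmj
      _ = 2 ^ (m : ℕ) * M ^ (j : ℕ) := by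
          rw [mul_pow, mul_assoc, ← pow_add,
            Nat.add_sub_cancel' (PNat.coe_le_coe _ _ |>.mpr hmj.le)]
  calc ∑ m ∈ Finset.Ico 1 j, (2 * M) ^ (m : ℕ) * ‖entry A m j‖
      ≤ ∑ m ∈ Finset.Ico 1 j, 2 ^ (m : ℕ) * M ^ (j : ℕ) := Finset.sum_le_sum hterm
    _ = (∑ m ∈ Finset.Ico 1 (j : ℕ), 2 ^ m) * M ^ (j : ℕ) := by
        rw [Finset.sum_mul]
        exact sum_Ico_pnat 1 j fun m => 2 ^ m * M ^ (j : ℕ)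
    _ ≤ 2 ^ (j : ℕ) * M ^ (j : ℕ) := by
        gcongr
        rw [geom_sum_Ico (by norm_num) j.pos]
        norm_num
    _ = (2 * M) ^ (j : ℕ) := (mul_pow _ _ _).symm

theorem IsKrylov.norm_entry_inv_le_pow {U : ColFinˣ} (hK : IsKrylov (· + 1) A U) (i j : ℕ+) :
    ‖entry (U⁻¹ : ColFinˣ) i j‖ ≤ (2 * (M * (1 + 2 * M))) ^ (j : ℕ) := by
  set μ := M * (1 + 2 * M)
  have hμ1 : 1 ≤ μ := by nlinarith
  have hbound := hK.norm_entry_inv_le hA (add_left_injective 1) (fun i => PNat.lt_add_right i 1)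
    (q := (2 * μ)⁻¹) (α := fun j => (2 * μ) ^ (j : ℕ)) (w := fun i => μ⁻¹ ^ (i : ℕ))
    (fun i => by positivity) (fun j => by positivity) (by positivity)
    (fun j => by
      rw [← mul_pow, mul_assoc, mul_inv_cancel₀ (by positivity), mul_one]
      exact one_le_pow₀ one_le_two)
    (fun j => by
      rw [PNat.add_coe, PNat.one_coe, pow_succ', inv_mul_cancel_left₀ (by positivity)])
    (fun i N => by
      have := sum_Ioc_norm_entry_mul_le hM hAM i N
      rw [PNat.add_coe, PNat.one_coe]
      have h : (2 * μ)⁻¹ * μ⁻¹ ^ (i : ℕ) = μ⁻¹ ^ ((i : ℕ) + 1) / 2 := by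
        rw [mul_inv, pow_succ]; ring
      linarith) i j
  exact hbound.trans (mul_le_of_le_one_right (by positivity)
    (pow_le_one₀ (by positivity) (inv_le_one_of_one_le₀ hμ1)))

end SuccKrylov

theorem coe_blockIndex_symm (s : ℕ) (a : Fin 2) :
    (blockIndex.symm (s, a) : ℕ) = 2 * s + a + 1 := by
  rw [coe_eq_blockIndex, Equiv.apply_symm_apply]

theorem entry_gammaInv_blockIndex_symm (X : Matrix (Fin 2) (Fin 2) ℂ⟦X⟧) (s r : ℕ) (a b : Fin 2) :
    entry (gammaInv X) (blockIndex.symm (s, a)) (blockIndex.symm (r, b)) =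
      if s ≤ r then coeff (r - s) (X a b) else 0 := by
  rw [entry_gammaInv, blockEntry, Equiv.apply_symm_apply, Equiv.apply_symm_apply]

theorem isEchelon_gammaInv {X : Matrix (Fin 2) (Fin 2) ℂ⟦X⟧} (h00 : constantCoeff (X 0 0) = 0)
    (h01 : constantCoeff (X 0 1) = 1) (h10 : constantCoeff (X 1 0) = 0)
    (h11 : constantCoeff (X 1 1) = 0) (h10' : coeff 1 (X 1 0) = 1) :
    IsEchelon (· + 1) (gammaInv X) where
  entry_of_lt i j hij := by
    obtain ⟨⟨s, a⟩, rfl⟩ := blockIndex.symm.surjective i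
    obtain ⟨⟨r, b⟩, rfl⟩ := blockIndex.symm.surjective j
    have hle := PNat.coe_le_coe _ _ |>.mpr (PNat.lt_add_one_iff.mp hij)
    rw [coe_blockIndex_symm, coe_blockIndex_symm] at hle
    rw [entry_gammaInv_blockIndex_symm]
    split_ifs with hsr
    · obtain rfl : s = r := by omega
      fin_cases a <;> fin_cases b <;> simp_all
    · rfl
  entry_self i := by
    obtain ⟨⟨s, a⟩, rfl⟩ := blockIndex.symm.surjective i
    have hsucc : blockIndex.symm (s, a) + 1 = blockIndex.symm (s + a, 1 - a) := by
      apply PNat.coe_injective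
      rw [PNat.add_coe, PNat.one_coe, coe_blockIndex_symm, coe_blockIndex_symm]
      fin_cases a
      · simp
      · simp; omega
    simp only [hsucc, entry_gammaInv_blockIndex_symm]
    fin_cases a <;> simp_all

theorem norm_entry_gammaInv_le {X : Matrix (Fin 2) (Fin 2) ℂ⟦X⟧} {K : ℝ} (hK : 1 ≤ K)
    (hX : ∀ a b n, ‖coeff n (X a b)‖ ≤ K ^ (n + 1)) {i j : ℕ+} (hij : i < j) :
    ‖entry (gammaInv X) i j‖ ≤ (K ^ 2) ^ ((j : ℕ) - i) := by
  have hi := coe_eq_blockIndex i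
  have hj := coe_eq_blockIndex j
  have hij' : (i : ℕ) < j := hij
  rw [entry_gammaInv, blockEntry, ← pow_mul]
  split_ifs
  · exact (hX _ _ _).trans (pow_le_pow_right₀ hK (by omega))
  · rw [norm_zero]
    positivity

theorem Jtilde_sub_one : Jtilde - 1 = gammaInv !![0, 1 + gSeries; gSeries, X] := by
  rw [Jtilde, ← map_one gammaInv]
  refine (map_sub gammaInv Jt.1 1).symm.trans (congrArg gammaInv ?_)
  ext i j : 1
  fin_cases i <;> fin_cases j <;> simp [Jt]

theorem isEchelon_Jtilde_sub_one : IsEchelon (· + 1) (Jtilde - 1) := by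
  rw [Jtilde_sub_one]
  apply isEchelon_gammaInv <;> simp [constantCoeff_gSeries, coeff_succ_gSeries 0]

theorem isKrylov_matP : IsKrylov (· + 1) (Jtilde - 1) matP := by
  have hrange : ∀ i : ℕ+, i ∉ Set.range (· + 1) → i = 1 := fun i hi =>
    of_not_not fun h => hi (PNat.exists_eq_succ_of_ne_one h |>.imp fun _ => Eq.symm)
  refine IsKrylov.of_pow (d := fun _ => 1) (k := fun i => (i : ℕ) - 1)
    (fun i j => entry_unitOfUpper _ _ i j) (fun _ => rfl) (fun i => ?_)
    (fun i hi => (hrange i hi).symm) (fun i hi => by rw [hrange i hi]; rfl)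
  have := i.pos
  rw [PNat.add_coe, PNat.one_coe]
  omega

/-! ### Exponential growth -/

theorem norm_entry_mul_le_pow {A B : ColFin} {K : ℕ+} (hA : ∀ i j, ‖entry A i j‖ ≤ K ^ (j : ℕ))
    (hB : ∀ i j, ‖entry B i j‖ ≤ K ^ (j : ℕ)) (hB' : ∀ i j, entry B i j ≠ 0 → i ≤ K * j)
    (i j : ℕ+) : ‖entry (A * B) i j‖ ≤ (2 * (K : ℝ) ^ ((K : ℕ) + 2)) ^ (j : ℕ) := by
  have hK : (1 : ℝ) ≤ K := one_le_cast K
  have hterm : ∀ m ∈ Finset.Icc 1 (K * j),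
      ‖entry A i m * entry B m j‖ ≤ (K : ℝ) ^ ((K : ℕ) * j) * (K : ℝ) ^ (j : ℕ) := by
    intro m hm
    have hmj : (m : ℕ) ≤ K * j := (PNat.coe_le_coe _ _).mpr (Finset.mem_Icc.mp hm).2
    rw [norm_mul]
    exact mul_le_mul ((hA i m).trans (pow_le_pow_right₀ hK hmj)) (hB m j) (norm_nonneg _)
      (by positivity)
  have hcard : ((K * j : ℕ) : ℝ) ≤ (K : ℝ) ^ (j : ℕ) * 2 ^ (j : ℕ) := by
    push_cast
    gcongr
    · exact le_self_pow₀ hK j.ne_zero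
    · exact mod_cast Nat.lt_two_pow_self.le
  rw [entry_mul A B i j fun m hm => Finset.mem_Icc.mpr ⟨one_le, hB' m j hm⟩]
  calc _ ≤ ((K * j : ℕ) : ℝ) * ((K : ℝ) ^ ((K : ℕ) * j) * (K : ℝ) ^ (j : ℕ)) := by
        refine (norm_sum_le_of_le _ hterm).trans_eq ?_
        rw [Finset.sum_const, PNat.card_Icc, nsmul_eq_mul, PNat.one_coe, Nat.add_sub_cancel,
          PNat.mul_coe]
    _ ≤ (K : ℝ) ^ (j : ℕ) * 2 ^ (j : ℕ) * ((K : ℝ) ^ ((K : ℕ) * j) * (K : ℝ) ^ (j : ℕ)) := by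
        gcongr
    _ = (2 * (K : ℝ) ^ ((K : ℕ) + 2)) ^ (j : ℕ) := by ring

/-- The multiplicative monoid of matrices satisfying the analogues of the conditions defining `DR₀`
with a linear bound on the rows and an exponential bound on the entries. It contains `P` and the
matrices `τ₁(Y)`, and `ψ` maps it to `DR₀`, because `ψ` replaces the index `k` by
`d * 2 ^ (k - 1)`. -/
def expGrowth : Submonoid ColFin where
  carrier := {A | ∃ K : ℕ+, (∀ i j, entry A i j ≠ 0 → i ≤ K * j) ∧
    ∀ i j, ‖entry A i j‖ ≤ K ^ (j : ℕ)}
  mul_mem' := by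
    rintro A B ⟨KA, hA', hA⟩ ⟨KB, hB', hB⟩
    set K := max KA KB
    have hKA : KA ≤ K := le_max_left _ _
    have hKB : KB ≤ K := le_max_right _ _
    refine ⟨2 * K ^ ((K : ℕ) + 2), fun i j hij => ?_, fun i j => ?_⟩
    · obtain ⟨N, hN⟩ := exists_le_of_entry_ne_zero B j
      rw [entry_mul A B i j fun m hm => Finset.mem_Iic.mpr (hN m hm)] at hij
      obtain ⟨m, -, hm⟩ := Finset.exists_ne_zero_of_sum_ne_zero hij
      calc i ≤ KA * m := hA' i m (left_ne_zero_of_mul hm)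
        _ ≤ KA * (KB * j) := mul_le_mul_right (hB' m j (right_ne_zero_of_mul hm)) _
        _ ≤ K * (K * j) := mul_le_mul' hKA (mul_le_mul' hKB le_rfl)
        _ = K ^ 2 * j := by rw [sq, mul_assoc]
        _ ≤ 2 * K ^ ((K : ℕ) + 2) * j :=
          mul_le_mul_left ((pow_le_pow_right' one_le (by omega)).trans
            (le_mul_of_one_le_left' one_le)) _
    · have hA : ∀ i j, ‖entry A i j‖ ≤ K ^ (j : ℕ) := fun i j =>
        (hA i j).trans (by gcongr; exact hKA)
      have hB : ∀ i j, ‖entry B i j‖ ≤ K ^ (j : ℕ) := fun i j =>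
        (hB i j).trans (by gcongr; exact hKB)
      have hB' : ∀ i j, entry B i j ≠ 0 → i ≤ K * j := fun i j h =>
        (hB' i j h).trans (mul_le_mul_left hKB j)
      exact mod_cast norm_entry_mul_le_pow hA hB hB' i j
  one_mem' := by
    refine ⟨1, fun i j hij => ?_, fun i j => ?_⟩
    · rw [one_mul]
      exact (of_not_not fun h => hij (by rw [entry_one, if_neg h]) : i = j).le
    · rw [entry_one]
      split_ifs <;> simp

theorem mem_expGrowth_of_le {A : ColFin} {c : ℕ+} {K : ℝ}
    (hrow : ∀ i j, entry A i j ≠ 0 → i ≤ c * j) (hK : ∀ i j, ‖entry A i j‖ ≤ K ^ (j : ℕ)) :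
    A ∈ expGrowth := by
  obtain ⟨L, hL⟩ := exists_nat_ge |K|
  refine ⟨c + L.succPNat, fun i j hij => (hrow i j hij).trans ?_, fun i j => (hK i j).trans ?_⟩
  · exact mul_le_mul_left (PNat.lt_add_right _ _).le j
  · calc K ^ (j : ℕ) ≤ |K| ^ (j : ℕ) := (le_abs_self _).trans_eq (abs_pow _ _)
      _ ≤ ((c + L.succPNat : ℕ+) : ℝ) ^ (j : ℕ) := by
        gcongr
        rw [PNat.add_coe, Nat.succPNat_coe]
        push_cast
        linarith [one_le_cast c]

theorem gammaInv_mem_expGrowth {X : Matrix (Fin 2) (Fin 2) ℂ⟦X⟧}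
    (hX : ∀ a b, X a b ∈ expBounded ℂ) : gammaInv X ∈ expGrowth := by
  obtain ⟨K, hK, hb⟩ := exists_common_bound_of_mem_expBounded
    (a := fun p : Fin 2 × Fin 2 => X p.1 p.2) fun p => hX p.1 p.2
  refine mem_expGrowth_of_le (c := 2) (K := K) (fun i j hij => ?_) fun i j => ?_ <;>
    have hj := coe_eq_blockIndex j
  · rw [entry_gammaInv] at hij
    have hle := mem_blocksUpTo.mp (blockEntry_ne_zero hij)
    have hi := coe_eq_blockIndex i
    rw [← PNat.coe_le_coe, PNat.mul_coe]
    change (i : ℕ) ≤ 2 * j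
    omega
  · rw [entry_gammaInv, blockEntry]
    split_ifs
    · exact (hb (_, _) _).trans (pow_le_pow_right₀ hK (by omega))
    · rw [norm_zero]
      positivity

theorem IsUpperUnitriangular.mem_expGrowth {A : ColFin} (hA : IsUpperUnitriangular (entry A))
    {K : ℝ} (hK : ∀ i j, ‖entry A i j‖ ≤ K ^ (j : ℕ)) : A ∈ expGrowth :=
  mem_expGrowth_of_le (c := 1)
    (fun i j hij => by rw [one_mul]; exact not_lt.mp fun h => hij (hA.1 i j h)) hK

theorem isUpperUnitriangular_matP : IsUpperUnitriangular (entry matP) := by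
  simpa only [matP, IsUpperUnitriangular, entry_unitOfUpper] using pEntry_upper

theorem exists_norm_entry_Jtilde_sub_one_le :
    ∃ M : ℝ, 1 ≤ M ∧ ∀ i j, i < j → ‖entry (Jtilde - 1) i j‖ ≤ M ^ ((j : ℕ) - i) := by
  have hg := gSeries_mem_expBounded
  have hmem : ∀ a b, !![0, 1 + gSeries; gSeries, X] a b ∈ expBounded ℂ := by
    intro a b
    fin_cases a <;> fin_cases b
    exacts [zero_mem _, add_mem (one_mem _) hg, hg, X_mem_expBounded]
  obtain ⟨K, hK, hb⟩ := exists_common_bound_of_mem_expBounded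
    (a := fun p : Fin 2 × Fin 2 => !![0, 1 + gSeries; gSeries, X] p.1 p.2) fun p => hmem p.1 p.2
  rw [Jtilde_sub_one]
  exact ⟨K ^ 2, one_le_pow₀ hK, fun i j => norm_entry_gammaInv_le hK fun a b => hb (a, b)⟩

theorem matP_mem_expGrowth : (matP : ColFin) ∈ expGrowth := by
  obtain ⟨M, hM, hJ⟩ := exists_norm_entry_Jtilde_sub_one_le
  exact isUpperUnitriangular_matP.mem_expGrowth
    (isKrylov_matP.norm_entry_le_two_mul_pow hM hJ isEchelon_Jtilde_sub_one)

theorem matP_inv_mem_expGrowth : ((matP⁻¹ : ColFinˣ) : ColFin) ∈ expGrowth := by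
  obtain ⟨M, hM, hJ⟩ := exists_norm_entry_Jtilde_sub_one_le
  exact isUpperUnitriangular_matP.inv.mem_expGrowth
    (isKrylov_matP.norm_entry_inv_le_pow hM hJ isEchelon_Jtilde_sub_one)

/-! ### The ring `DR₀` -/

theorem mem_DR0_of_le {A : ColFin} {C c : ℕ} (hrow : ∀ i j, entry A i j ≠ 0 → (i : ℕ) ≤ C * j ^ c)
    (hnorm : ∀ i j, ‖entry A i j‖ ≤ C * (j : ℝ) ^ c) : A ∈ DR0 := by
  have hle : ∀ j : ℕ+, C * (j : ℝ) ^ c ≤ ((C : ℝ) + 1) * (j : ℝ) ^ ((c + 1 : ℕ) : ℝ) := by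
    intro j
    rw [Real.rpow_natCast]
    gcongr
    exacts [le_add_of_nonneg_right zero_le_one, one_le_cast j, c.le_succ]
  refine ⟨C + 1, (c + 1 : ℕ), by positivity, by positivity, fun i j hij => ?_, fun i j =>
    (hnorm i j).trans (hle j)⟩
  by_contra hne
  have hi : (i : ℝ) ≤ C * (j : ℝ) ^ c := mod_cast hrow i j hne
  exact (hi.trans (hle j)).not_gt hij

theorem IsUpperUnitriangular.mem_DR0 {A : ColFin} (hA : IsUpperUnitriangular (entry A)) {c : ℕ}
    (hnorm : ∀ i j, ‖entry A i j‖ ≤ (j : ℝ) ^ c) : A ∈ DR0 := by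
  refine mem_DR0_of_le (C := 1) (c := c + 1) (fun i j hij => ?_) fun i j => ?_
  · have hle : i ≤ j := not_lt.mp fun h => hij (hA.1 i j h)
    rw [one_mul]
    exact (PNat.coe_le_coe _ _ |>.mpr hle).trans (Nat.le_self_pow c.succ_ne_zero _)
  · rw [Nat.cast_one, one_mul]
    exact (hnorm i j).trans (pow_le_pow_right₀ (one_le_cast j) c.le_succ)

theorem coe_eq_oddPart_mul (i : ℕ+) : (i : ℕ) = oddPart i * 2 ^ v2 i := by
  conv_lhs => rw [← oddPart_mul i, PNat.mul_coe, PNat.pow_coe]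
  rfl

theorem two_pow_v2_le (i : ℕ+) : 2 ^ v2 i ≤ (i : ℕ) :=
  Nat.ordProj_le 2 i.ne_zero

theorem psi_mem_DR0 {A : ColFin} (hA : A ∈ expGrowth) : psi A ∈ DR0 := by
  obtain ⟨K, hrow, hnorm⟩ := hA
  refine mem_DR0_of_le (C := 2 ^ (K : ℕ)) (c := K) (fun i j hij => ?_) fun i j => ?_ <;>
    simp only [entry_psi, psiEntry] at *
  · obtain ⟨hodd, hne⟩ := ite_ne_right_iff.mp hij
    have hv : v2 i + 1 ≤ K * (v2 j + 1) := hrow _ _ hne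
    calc (i : ℕ) = oddPart j * 2 ^ v2 i := by rw [coe_eq_oddPart_mul i, hodd]
      _ ≤ (oddPart j : ℕ) ^ (K : ℕ) * 2 ^ (K * (v2 j + 1) : ℕ) :=
        Nat.mul_le_mul (Nat.le_self_pow K.ne_zero _) (Nat.pow_le_pow_right two_pos (by omega))
      _ = 2 ^ (K : ℕ) * (oddPart j * 2 ^ v2 j) ^ (K : ℕ) := by ring
      _ = 2 ^ (K : ℕ) * (j : ℕ) ^ (K : ℕ) := by rw [← coe_eq_oddPart_mul]
  · push_cast
    split_ifs
    · calc _ ≤ (K : ℝ) ^ (v2 j + 1) := hnorm _ _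
        _ ≤ (2 ^ (K : ℕ)) ^ (v2 j + 1) := by
          gcongr
          exact mod_cast Nat.lt_two_pow_self.le
        _ = 2 ^ (K : ℕ) * (2 ^ v2 j) ^ (K : ℕ) := by ring
        _ ≤ 2 ^ (K : ℕ) * (j : ℝ) ^ (K : ℕ) := by
          gcongr
          exact mod_cast two_pow_v2_le j
    · rw [norm_zero]
      positivity

/-! ### The matrix `Z` -/

theorem v2_mul_two (i : ℕ+) : v2 (i * 2) = v2 i + 1 := by
  change ((i : ℕ) * 2).factorization 2 = _
  rw [Nat.factorization_mul i.ne_zero two_ne_zero, Finsupp.add_apply,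
    Nat.prime_two.factorization_self, v2]

theorem oddPart_mul_two (i : ℕ+) : oddPart (i * 2) = oddPart i := by
  have h := oddPart_mul (i * 2)
  rw [v2_mul_two, pow_succ, ← mul_assoc] at h
  exact mul_right_cancel ((mul_right_cancel h).trans (oddPart_mul i).symm)

theorem v2_eq_zero_of_notMem_range {i : ℕ+} (hi : i ∉ Set.range (· * 2 : ℕ+ → ℕ+)) : v2 i = 0 := by
  by_contra hv
  obtain ⟨k, hk⟩ := Nat.exists_eq_succ_of_ne_zero hv
  exact hi ⟨oddPart i * 2 ^ k, by
    change oddPart i * 2 ^ k * 2 = i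
    rw [mul_assoc, ← pow_succ, ← Nat.succ_eq_add_one, ← hk, oddPart_mul]⟩

theorem isKrylov_matZ : IsKrylov (· * 2) (divisorMatrix - 1) matZ :=
  .of_pow (d := oddPart) (k := v2) (fun i j => entry_unitOfUpper _ _ i j) oddPart_mul_two v2_mul_two
    (fun i hi => by
      have h := oddPart_mul i
      rwa [v2_eq_zero_of_notMem_range hi, pow_zero, mul_one] at h)
    fun _ => v2_eq_zero_of_notMem_range

theorem isUpperUnitriangular_matZ : IsUpperUnitriangular (entry matZ) := by
  simpa only [matZ, IsUpperUnitriangular, entry_unitOfUpper] using zEntry_upper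

theorem entry_divisorMatrix_sub_one (i j : ℕ+) :
    entry (divisorMatrix - 1) i j = if (i : ℕ) ∣ j ∧ i ≠ j then 1 else 0 := by
  rw [entry_sub, entry_one, divisorMatrix, entry_ofMatrix]
  by_cases hij : i = j
  · simp [hij]
  · simp [hij]

theorem isEchelon_divisorMatrix_sub_one : IsEchelon (· * 2) (divisorMatrix - 1) where
  entry_of_lt i m hm := by
    rw [entry_divisorMatrix_sub_one, if_neg]
    rintro ⟨⟨c, hc⟩, hne⟩
    have hlt : (i : ℕ) * c < i * 2 := hc ▸ hm
    have hc1 : c = 1 := by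
      have := Nat.lt_of_mul_lt_mul_left hlt
      have : c ≠ 0 := by rintro rfl; exact m.ne_zero hc
      omega
    rw [hc1, mul_one] at hc
    exact hne (PNat.eq hc.symm)
  entry_self i := by
    rw [entry_divisorMatrix_sub_one, if_pos]
    exact ⟨Nat.dvd_mul_right _ _, (lt_mul_of_one_lt_right' i (by decide)).ne⟩

theorem sum_properDivisors_sq_le (n : ℕ) :
    ∑ m ∈ n.properDivisors, (m : ℝ) ^ 2 ≤ (n : ℝ) ^ 2 := by
  rcases n.eq_zero_or_pos with rfl | hn
  · simp
  have hsum : ∑ d ∈ n.divisors, ((d : ℝ) ^ 2)⁻¹ ≤ 2 := by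
    have hsub : n.divisors ⊆ insert 1 (Finset.Ioc 1 n) := fun d hd => by
      have := Nat.divisor_le hd
      have := Nat.pos_of_mem_divisors hd
      simp only [Finset.mem_insert, Finset.mem_Ioc]
      omega
    calc _ ≤ ∑ d ∈ insert 1 (Finset.Ioc 1 n), ((d : ℝ) ^ 2)⁻¹ :=
          Finset.sum_le_sum_of_subset_of_nonneg hsub fun _ _ _ => by positivity
      _ ≤ 1 + (1 - (n : ℝ)⁻¹) := by
          rw [Finset.sum_insert Finset.left_notMem_Ioc]
          have := sum_Ioc_inv_sq_le_sub (α := ℝ) one_ne_zero hn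
          norm_num at this ⊢
          exact this
      _ ≤ 2 := by linarith [inv_nonneg.mpr (Nat.cast_nonneg (α := ℝ) n)]
  have hdiv : ∑ m ∈ n.divisors, (m : ℝ) ^ 2 ≤ (n : ℝ) ^ 2 * 2 := by
    calc _ = ∑ d ∈ n.divisors, ((n / d : ℕ) : ℝ) ^ 2 :=
          (Nat.sum_div_divisors n fun m => (m : ℝ) ^ 2).symm
      _ = (n : ℝ) ^ 2 * ∑ d ∈ n.divisors, ((d : ℝ) ^ 2)⁻¹ := by
          rw [Finset.mul_sum]
          refine Finset.sum_congr rfl fun d hd => ?_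
          rw [Nat.cast_div_charZero (Nat.dvd_of_mem_divisors hd), div_pow, div_eq_mul_inv]
      _ ≤ (n : ℝ) ^ 2 * 2 := by gcongr
  rw [← Nat.insert_self_properDivisors hn.ne', Finset.sum_insert Nat.self_notMem_properDivisors]
    at hdiv
  linarith

theorem norm_entry_matZ_le (i j : ℕ+) : ‖entry matZ i j‖ ≤ (j : ℝ) ^ 2 := by
  refine isKrylov_matZ.norm_entry_le (fun i => lt_mul_of_one_lt_right' i (by decide))
    (φ := fun j => (j : ℝ) ^ 2) (fun j => one_le_pow₀ (one_le_cast j)) (fun i j hji => ?_)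
    (fun j => ?_) i j
  · exact isEchelon_divisorMatrix_sub_one.entry_of_lt i j
      (hji.trans_lt (lt_mul_of_one_lt_right' i (by decide)))
  · have hterm : ∀ m ∈ Finset.Ico 1 j, (m : ℝ) ^ 2 * ‖entry (divisorMatrix - 1) m j‖ =
        if (m : ℕ) ∣ j then (m : ℝ) ^ 2 else 0 := by
      intro m hm
      rw [entry_divisorMatrix_sub_one]
      simp only [(Finset.mem_Ico.mp hm).2.ne, ne_eq, not_false_eq_true, and_true]
      split_ifs <;> simp
    rw [Finset.sum_congr rfl hterm,
      sum_Ico_pnat 1 j fun m => if m ∣ (j : ℕ) then (m : ℝ) ^ 2 else 0, ← Finset.sum_filter]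
    exact sum_properDivisors_sq_le j

theorem sum_Ioc_two_inv_pow_four_le (N : ℕ) :
    ∑ d ∈ Finset.Ioc 2 N, ((d : ℝ) ^ 4)⁻¹ ≤ 1 / 18 := by
  rcases lt_or_ge N 2 with hN | hN
  · rw [Finset.Ioc_eq_empty_of_le hN.le, Finset.sum_empty]
    norm_num
  calc _ ≤ ∑ d ∈ Finset.Ioc 2 N, (1 / 9) * ((d : ℝ) ^ 2)⁻¹ := by
        refine Finset.sum_le_sum fun d hd => ?_
        have hd3 : (3 : ℝ) ≤ d := mod_cast (Finset.mem_Ioc.mp hd).1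
        rw [show (d : ℝ) ^ 4 = d ^ 2 * d ^ 2 by ring, mul_inv, one_div]
        gcongr
        nlinarith
    _ = (1 / 9) * ∑ d ∈ Finset.Ioc 2 N, ((d : ℝ) ^ 2)⁻¹ := (Finset.mul_sum _ _ _).symm
    _ ≤ (1 / 9) * (1 / 2) := by
        gcongr
        refine (sum_Ioc_inv_sq_le_sub two_ne_zero hN).trans ?_
        rw [Nat.cast_ofNat, one_div]
        exact sub_le_self _ (by positivity)
    _ = 1 / 18 := by norm_num

theorem sum_Ioc_norm_entry_divisorMatrix_le (i N : ℕ+) :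
    ∑ m ∈ Finset.Ioc (i * 2) N, ‖entry (divisorMatrix - 1) i m‖ * ((m : ℝ) ^ 4)⁻¹ ≤
      ((i : ℝ) ^ 4)⁻¹ / 18 := by
  have hterm : ∀ m ∈ Finset.Ioc (i * 2) N, ‖entry (divisorMatrix - 1) i m‖ * ((m : ℝ) ^ 4)⁻¹ ≤
      if (i : ℕ) ∣ m then ((m : ℝ) ^ 4)⁻¹ else 0 := by
    intro m _
    rw [entry_divisorMatrix_sub_one, ite_and]
    split_ifs <;> simp
  have hsub : (Finset.Ioc (i * 2 : ℕ) N).filter ((i : ℕ) ∣ ·) ⊆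
      (Finset.Ioc 2 (N : ℕ)).image ((i : ℕ) * ·) := by
    intro m hm
    obtain ⟨hm, d, rfl⟩ := Finset.mem_filter.mp hm
    obtain ⟨hlt, hle⟩ := Finset.mem_Ioc.mp hm
    exact Finset.mem_image_of_mem _ (Finset.mem_Ioc.mpr
      ⟨Nat.lt_of_mul_lt_mul_left hlt, (Nat.le_mul_of_pos_left d i.pos).trans hle⟩)
  calc _ ≤ ∑ m ∈ Finset.Ioc (i * 2) N, if (i : ℕ) ∣ m then ((m : ℝ) ^ 4)⁻¹ else 0 :=
        Finset.sum_le_sum hterm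
    _ = ∑ m ∈ (Finset.Ioc (i * 2 : ℕ) N).filter ((i : ℕ) ∣ ·), ((m : ℝ) ^ 4)⁻¹ := by
        rw [Finset.sum_filter]
        exact sum_Ioc_pnat (i * 2) N fun m => if (i : ℕ) ∣ m then ((m : ℝ) ^ 4)⁻¹ else 0
    _ ≤ ∑ m ∈ (Finset.Ioc 2 (N : ℕ)).image ((i : ℕ) * ·), ((m : ℝ) ^ 4)⁻¹ :=
        Finset.sum_le_sum_of_subset_of_nonneg hsub fun _ _ _ => by positivity
    _ = ((i : ℝ) ^ 4)⁻¹ * ∑ d ∈ Finset.Ioc 2 (N : ℕ), ((d : ℝ) ^ 4)⁻¹ := by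
        rw [Finset.sum_image fun a _ b _ h => Nat.eq_of_mul_eq_mul_left i.pos h, Finset.mul_sum]
        exact Finset.sum_congr rfl fun d _ => by rw [Nat.cast_mul, mul_pow, mul_inv]
    _ ≤ ((i : ℝ) ^ 4)⁻¹ * (1 / 18) := by
        gcongr
        exact sum_Ioc_two_inv_pow_four_le N
    _ = ((i : ℝ) ^ 4)⁻¹ / 18 := mul_one_div _ _

theorem norm_entry_matZ_inv_le (i j : ℕ+) :
    ‖entry (matZ⁻¹ : ColFinˣ) i j‖ ≤ (j : ℝ) ^ 8 := by
  have hcast (i : ℕ+) : ((i * 2 : ℕ+) : ℝ) = i * 2 := by rw [PNat.mul_coe]; push_cast; rfl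
  have hbound := isKrylov_matZ.norm_entry_inv_le isEchelon_divisorMatrix_sub_one
    (mul_left_injective 2) (fun i => lt_mul_of_one_lt_right' i (by decide)) (q := 1 / 256)
    (α := fun j => (j : ℝ) ^ 8) (w := fun i => ((i : ℝ) ^ 4)⁻¹) (fun i => by positivity)
    (fun j => by positivity) (by norm_num)
    (fun j => by
      rw [show (j : ℝ) ^ 8 = j ^ 4 * j ^ 4 by ring, mul_inv_cancel_right₀ (by positivity)]
      exact one_le_pow₀ (one_le_cast j))
    (fun j => by
      rw [hcast]
      exact le_of_eq (by ring))
    (fun i N => by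
      have hi : 0 ≤ ((i : ℝ) ^ 4)⁻¹ := by positivity
      have hsum := sum_Ioc_norm_entry_divisorMatrix_le i N
      rw [hcast, mul_pow, mul_inv]
      linarith) i j
  exact hbound.trans (mul_le_of_le_one_right (by positivity)
    (inv_le_one_of_one_le₀ (one_le_pow₀ (one_le_cast i))))

theorem matZ_mem_DR0 : (matZ : ColFin) ∈ DR0 :=
  isUpperUnitriangular_matZ.mem_DR0 norm_entry_matZ_le

theorem matZ_inv_mem_DR0 : ((matZ⁻¹ : ColFinˣ) : ColFin) ∈ DR0 :=
  isUpperUnitriangular_matZ.inv.mem_DR0 norm_entry_matZ_inv_le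

/-! ### Integrality of `P` and `Z` -/

theorem gSeries_mem_seriesOver : gSeries ∈ seriesOver (Int.castRingHom ℂ).range := by
  rintro (_ | n)
  · rw [coeff_zero_eq_constantCoeff_apply, constantCoeff_gSeries]
    exact zero_mem _
  · exact ⟨(-1) ^ n * catalan n, by simp [coeff_succ_gSeries]⟩

theorem Jt_apply_mem {R : Subring ℂ⟦X⟧} (hg : gSeries ∈ R) (a b : Fin 2) : Jt.1 a b ∈ R := by
  have hX : X ∈ R := gSeries_sq_add ▸ add_mem (pow_mem hg 2) hg
  fin_cases a <;> fin_cases b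
  exacts [one_mem R, add_mem (one_mem R) hg, hg, add_mem (one_mem R) hX]

theorem Jtilde_mem_matricesOver : Jtilde ∈ matricesOver (Int.castRingHom ℂ).range :=
  gammaInv_mem_matricesOver (Jt_apply_mem gSeries_mem_seriesOver)

theorem matP_mem_matricesOver : (matP : ColFin) ∈ matricesOver (Int.castRingHom ℂ).range := by
  intro i j
  rw [matP, entry_unitOfUpper]
  exact pow_mem (sub_mem Jtilde_mem_matricesOver (one_mem _)) _ _ _

theorem matZ_mem_matricesOver : (matZ : ColFin) ∈ matricesOver (Int.castRingHom ℂ).range := by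
  have hD : divisorMatrix - 1 ∈ matricesOver (Int.castRingHom ℂ).range := by
    intro i j
    rw [entry_divisorMatrix_sub_one]
    split_ifs
    exacts [one_mem _, zero_mem _]
  intro i j
  rw [matZ, entry_unitOfUpper]
  exact pow_mem hD _ _ _

/-! ### Extending representations of `SL(2, ℤ)` -/

section Extension

variable {N G H : Type*} [Group N] [Group G] [Group H]

theorem exists_mul_pow_eq_pow_mul {ι : N →* G} {s : G} (hconj : ∀ n, ∃ m, ι n * s = s * ι m)
    (k : ℕ) (n : N) : ∃ m, ι n * s ^ k = s ^ k * ι m := by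
  induction k generalizing n with
  | zero => exact ⟨n, by rw [pow_zero, mul_one, one_mul]⟩
  | succ k ih =>
    obtain ⟨m, hm⟩ := ih n
    obtain ⟨l, hl⟩ := hconj m
    exact ⟨l, by rw [pow_succ, ← mul_assoc, hm, mul_assoc, hl, mul_assoc]⟩

/-- The subgroup generated by the image of `ι` and an involution `s` normalizing it, presented by
the normal form `s ^ k * ι n` of its elements. -/
def involutionMulRange (ι : N →* G) {s : G} (hs : s * s = 1)
    (hconj : ∀ n, ∃ m, ι n * s = s * ι m) : Subgroup G where
  carrier := {y | ∃ (k : ℕ) (n : N), s ^ k * ι n = y}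
  one_mem' := ⟨0, 1, by rw [pow_zero, map_one, one_mul]⟩
  mul_mem' := by
    rintro _ _ ⟨k, n, rfl⟩ ⟨l, m, rfl⟩
    obtain ⟨n', hn'⟩ := exists_mul_pow_eq_pow_mul hconj l n
    exact ⟨k + l, n' * m, by simp only [pow_add, map_mul, mul_assoc, ← mul_assoc (ι n), hn']⟩
  inv_mem' := by
    rintro _ ⟨k, n, rfl⟩
    obtain ⟨n', hn'⟩ := exists_mul_pow_eq_pow_mul hconj k n⁻¹
    exact ⟨k, n', by
      rw [← hn', mul_inv_rev, ← inv_pow, inv_eq_of_mul_eq_one_right hs, map_inv]⟩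

/-- The graph of the extension is the subgroup of `G × H` generated by the graph of `f` over `ι`
and `(s, w)`; it projects bijectively to `G`. -/
theorem exists_extension_of_involution {ι : N →* G} {f : N →* H} {s : G} {w : H}
    (hι : Function.Injective ι) (hs : s * s = 1) (hw : w * w = 1) (hs_notMem : s ∉ ι.range)
    (hcover : ∀ y, ∃ k n, s ^ k * ι n = y)
    (hconj : ∀ n, ∃ m, ι n * s = s * ι m ∧ f n * w = w * f m) :
    ∃ F : G →* H, (∀ n, F (ι n) = f n) ∧ F s = w := by
  have htt : ((s, w) : G × H) * (s, w) = 1 := Prod.ext hs hw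
  let graph : Subgroup (G × H) := involutionMulRange (ι.prod f) htt fun n =>
    (hconj n).imp fun _ h => Prod.ext h.1 h.2
  have hbij : Function.Bijective ((MonoidHom.fst G H).comp graph.subtype) := by
    refine ⟨(injective_iff_map_eq_one _).mpr ?_, fun y => ?_⟩
    · rintro ⟨_, k, n, rfl⟩ (hn : s ^ k * ι n = 1)
      have hs_even (l : ℕ) : s ^ (2 * l) = 1 := by rw [pow_mul, sq, hs, one_pow]
      obtain ⟨l, rfl | rfl⟩ := k.even_or_odd'
      · rw [hs_even, one_mul, map_eq_one_iff ι hι] at hn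
        subst hn
        exact Subtype.ext (by simp only [pow_mul, sq, htt, one_pow, map_one, mul_one]; rfl)
      · rw [pow_succ, hs_even, one_mul] at hn
        exact absurd ⟨n⁻¹, by rw [map_inv, ← eq_inv_of_mul_eq_one_left hn]⟩ hs_notMem
    · obtain ⟨k, n, rfl⟩ := hcover y
      exact ⟨⟨_, k, n, rfl⟩, rfl⟩
  let e := MulEquiv.ofBijective _ hbij
  have he (y : graph) : (e.symm y.1.1 : G × H) = y := congrArg Subtype.val (e.symm_apply_apply y)
  refine ⟨((MonoidHom.snd G H).comp graph.subtype).comp e.symm.toMonoidHom, fun n => ?_, ?_⟩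
  · exact congrArg Prod.snd (he ⟨ι.prod f n, 0, n, by rw [pow_zero, one_mul]⟩)
  · exact congrArg Prod.snd (he ⟨(s, w), 1, 1, by rw [pow_one, map_one, mul_one]⟩)

end Extension

theorem elemW_mul_self : elemW * elemW = 1 := Units.ext (by decide)

theorem det_elemW : (elemW : Matrix (Fin 2) (Fin 2) ℤ).det = -1 := by decide

theorem elemW_notMem_range_toGL :
    elemW ∉ (Matrix.SpecialLinearGroup.toGL : SL(2, ℤ) →* GL (Fin 2) ℤ).range := by
  rintro ⟨A, hA⟩
  have hdet : (elemW : Matrix (Fin 2) (Fin 2) ℤ).det = 1 := by rw [← hA]; exact A.2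
  rw [det_elemW] at hdet
  norm_num at hdet

theorem exists_elemW_mul_coe_of_det_eq_neg_one {Y : GL (Fin 2) ℤ}
    (hY : (Y : Matrix (Fin 2) (Fin 2) ℤ).det = -1) : ∃ A : SL(2, ℤ), elemW * A = Y := by
  obtain ⟨A, hA⟩ : ∃ A : SL(2, ℤ), (A : GL (Fin 2) ℤ) = elemW * Y :=
    ⟨⟨(elemW * Y).1, by rw [Units.val_mul, Matrix.det_mul, hY, det_elemW]; norm_num⟩,
      Units.ext rfl⟩
  exact ⟨A, by rw [hA, ← mul_assoc, elemW_mul_self, one_mul]⟩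

theorem exists_elemW_pow_mul_coe (Y : GL (Fin 2) ℤ) :
    ∃ (k : ℕ) (A : SL(2, ℤ)), elemW ^ k * A = Y := by
  obtain hY | hY := Int.isUnit_iff.mp (Matrix.isUnits_det_units Y)
  · exact ⟨0, ⟨Y.1, hY⟩, by rw [pow_zero, one_mul]; exact Units.ext rfl⟩
  · obtain ⟨A, hA⟩ := exists_elemW_mul_coe_of_det_eq_neg_one hY
    exact ⟨1, A, by rw [pow_one, hA]⟩

/-- The matrix `W(t)` as an element of `GL(2, ℂ⟦t⟧)`. -/
noncomputable def unitWt : GL (Fin 2) ℂ⟦X⟧ := ⟨Wt, Wt, Wt_mul_self, Wt_mul_self⟩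

/-- The homomorphism `SL(2, ℤ) → GL(2, ℂ⟦t⟧)` with `S ↦ St` and `T ↦ Jt`, of which `tau1` is the
composite with `gammaInv`. -/
noncomputable def seriesRepSL : SL(2, ℤ) →* GL (Fin 2) ℂ⟦X⟧ :=
  Matrix.SpecialLinearGroup.toGL.comp (liftSL St Jt St_pow St_sq_eq)

theorem exists_conj_elemW_and_unitWt (Y : SL(2, ℤ)) :
    ∃ Y' : SL(2, ℤ), (Y : GL (Fin 2) ℤ) * elemW = elemW * Y' ∧
      seriesRepSL Y * unitWt = unitWt * seriesRepSL Y' := by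
  have hmem : Y ∈ Subgroup.closure {ModularGroup.S, ModularGroup.T} := by
    rw [SpecialLinearGroup.SL2Z_generators]; trivial
  induction hmem using Subgroup.closure_induction with
  | mem Y hY =>
    obtain rfl | rfl := hY
    · refine ⟨ModularGroup.S ^ 3, Units.ext (by decide), ?_⟩
      rw [map_pow, seriesRepSL, MonoidHom.comp_apply, liftSL_S, ← map_pow]
      exact Units.ext St_mul_Wt
    · refine ⟨ModularGroup.T * ModularGroup.S * ModularGroup.T, Units.ext (by decide), ?_⟩
      simp only [map_mul, seriesRepSL, MonoidHom.comp_apply, liftSL_S, liftSL_T]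
      exact Units.ext Jt_mul_Wt
  | one => exact ⟨1, by simp only [map_one, one_mul, mul_one, and_self]⟩
  | mul A B _ _ hA hB =>
    obtain ⟨A', hA, hA'⟩ := hA
    obtain ⟨B', hB, hB'⟩ := hB
    exact ⟨A' * B', by rw [map_mul, map_mul, mul_assoc, hB, ← mul_assoc, hA, mul_assoc],
      by rw [map_mul, map_mul, mul_assoc, hB', ← mul_assoc, hA', mul_assoc]⟩
  | inv A _ hA =>
    obtain ⟨A', hA, hA'⟩ := hA
    exact ⟨A'⁻¹,
      by rw [map_inv, map_inv, inv_mul_eq_iff_eq_mul, ← mul_assoc, hA, mul_inv_cancel_right],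
      by rw [map_inv, map_inv, inv_mul_eq_iff_eq_mul, ← mul_assoc, hA', mul_inv_cancel_right]⟩

theorem exists_extension_seriesRepSL : ∃ F : GL (Fin 2) ℤ →* GL (Fin 2) ℂ⟦X⟧,
    (∀ Y : SL(2, ℤ), F Y = seriesRepSL Y) ∧ F elemW = unitWt :=
  exists_extension_of_involution Matrix.SpecialLinearGroup.toGL_injective elemW_mul_self
    (Units.ext Wt_mul_self) elemW_notMem_range_toGL exists_elemW_pow_mul_coe
    exists_conj_elemW_and_unitWt

/-- The extension of `seriesRepSL` to `GL(2, ℤ)` that sends `W` to `W(t)`. -/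
noncomputable def seriesRep : GL (Fin 2) ℤ →* GL (Fin 2) ℂ⟦X⟧ :=
  exists_extension_seriesRepSL.choose

theorem seriesRep_coe (Y : SL(2, ℤ)) : seriesRep Y = seriesRepSL Y :=
  exists_extension_seriesRepSL.choose_spec.1 Y

theorem seriesRep_elemW : seriesRep elemW = unitWt := exists_extension_seriesRepSL.choose_spec.2

theorem seriesRepSL_apply_mem {R : Subring ℂ⟦X⟧} (hg : gSeries ∈ R) (Y : SL(2, ℤ)) (a b : Fin 2) :
    seriesRepSL Y a b ∈ R := by
  let entriesIn : Subgroup SL(2, ℂ⟦X⟧) := (Matrix.SpecialLinearGroup.map R.subtype).range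
  have mem_entriesIn {B : SL(2, ℂ⟦X⟧)} (hB : ∀ a b, B a b ∈ R) : B ∈ entriesIn := by
    let B' : Matrix (Fin 2) (Fin 2) R := Matrix.of fun a b => ⟨B a b, hB a b⟩
    have hB' : R.subtype.mapMatrix B' = B.1 := rfl
    refine ⟨⟨B', Subtype.ext ?_⟩, Subtype.ext hB'⟩
    change R.subtype B'.det = 1
    rw [RingHom.map_det, hB', B.2]
  have htop : entriesIn.comap (liftSL St Jt St_pow St_sq_eq) = ⊤ := by
    rw [eq_top_iff, ← SpecialLinearGroup.SL2Z_generators, Subgroup.closure_le]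
    rintro _ (rfl | rfl)
    · rw [SetLike.mem_coe, Subgroup.mem_comap, liftSL_S]
      refine mem_entriesIn fun a b => ?_
      fin_cases a <;> fin_cases b <;> simp [St]
    · rw [SetLike.mem_coe, Subgroup.mem_comap, liftSL_T]
      exact mem_entriesIn (Jt_apply_mem hg)
  obtain ⟨B, hB⟩ : Y ∈ entriesIn.comap _ := htop ▸ Subgroup.mem_top Y
  change (liftSL St Jt St_pow St_sq_eq Y).1 a b ∈ R
  rw [← hB]
  exact (B a b).2

theorem seriesRep_apply_mem_expBounded (Y : GL (Fin 2) ℤ) (a b : Fin 2) :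
    seriesRep Y a b ∈ expBounded ℂ := by
  have hSL := seriesRepSL_apply_mem gSeries_mem_expBounded
  obtain hY | hY := Int.isUnit_iff.mp (Matrix.isUnits_det_units Y)
  · obtain ⟨A, rfl⟩ : ∃ A : SL(2, ℤ), (A : GL (Fin 2) ℤ) = Y := ⟨⟨Y.1, hY⟩, Units.ext rfl⟩
    rw [seriesRep_coe]
    exact hSL A a b
  · obtain ⟨A, rfl⟩ := exists_elemW_mul_coe_of_det_eq_neg_one hY
    rw [map_mul, seriesRep_elemW, seriesRep_coe, Units.val_mul, Matrix.mul_apply]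
    exact sum_mem fun c _ => mul_mem (Wt_mem_expBounded a c) (hSL A c b)

/-! ### The representations of `GL(2, ℤ)` -/

/-- The extension of `tau1` to `GL(2, ℤ)`. -/
noncomputable def tau1GL : GL (Fin 2) ℤ →* ColFinˣ :=
  (Units.map gammaInv.toMonoidHom).comp seriesRep

/-- The extension of `tau` to `GL(2, ℤ)`. -/
noncomputable def tauGL : GL (Fin 2) ℤ →* ColFinˣ := (MulAut.conj matP).toMonoidHom.comp tau1GL

/-- The extension of `rho` to `GL(2, ℤ)`, with values in all units of `ColFin`. -/
noncomputable def rhoGLColFin : GL (Fin 2) ℤ →* ColFinˣ :=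
  ((MulAut.conj matZ⁻¹).toMonoidHom.comp (Units.map psi.toMonoidHom)).comp tauGL

theorem tau1GL_coe (Y : SL(2, ℤ)) : tau1GL Y = tau1 Y := by
  rw [tau1GL, MonoidHom.comp_apply, seriesRep_coe]; rfl

theorem tau1GL_elemW : (tau1GL elemW : ColFin) = gammaInv Wt := by
  rw [tau1GL, MonoidHom.comp_apply, seriesRep_elemW]; rfl

theorem tauGL_apply (Y : GL (Fin 2) ℤ) : tauGL Y = matP * tau1GL Y * matP⁻¹ := rfl

theorem tauGL_coe (Y : SL(2, ℤ)) : tauGL Y = tau Y := by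
  rw [tauGL_apply, tau1GL_coe]; rfl

theorem coe_rhoGLColFin (Y : GL (Fin 2) ℤ) :
    (rhoGLColFin Y : ColFin) = (matZ⁻¹ : ColFinˣ) * psi (tauGL Y) * matZ := by
  change ((matZ⁻¹ * Units.map psi.toMonoidHom (tauGL Y) * matZ⁻¹⁻¹ : ColFinˣ) : ColFin) = _
  rw [inv_inv]; rfl

theorem tau1GL_mem_expGrowth (Y : GL (Fin 2) ℤ) : (tau1GL Y : ColFin) ∈ expGrowth :=
  gammaInv_mem_expGrowth (seriesRep_apply_mem_expBounded Y)

theorem tauGL_mem_expGrowth (Y : GL (Fin 2) ℤ) : (tauGL Y : ColFin) ∈ expGrowth :=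
  mul_mem (mul_mem matP_mem_expGrowth (tau1GL_mem_expGrowth Y)) matP_inv_mem_expGrowth

theorem rhoGLColFin_mem_DR0 (Y : GL (Fin 2) ℤ) : (rhoGLColFin Y : ColFin) ∈ DR0 := by
  rw [coe_rhoGLColFin]
  exact mul_mem (mul_mem matZ_inv_mem_DR0 (psi_mem_DR0 (tauGL_mem_expGrowth Y))) matZ_mem_DR0

/-- The extension of `rho` to `GL(2, ℤ)`. -/
noncomputable def rhoGL : GL (Fin 2) ℤ →* DR0ˣ :=
  (((Units.coeHom ColFin).comp rhoGLColFin).codRestrict DR0 rhoGLColFin_mem_DR0).toHomUnits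

theorem coe_rhoGL (Y : GL (Fin 2) ℤ) :
    ((rhoGL Y : DR0) : ColFin) = (matZ⁻¹ : ColFinˣ) * psi (tauGL Y) * matZ :=
  coe_rhoGLColFin Y

theorem coe_rhoGL_coe (Y : SL(2, ℤ)) : ((rhoGL Y : DR0) : ColFin) = rho Y := by
  change (rhoGLColFin Y : ColFin) = rho Y
  rw [rhoGLColFin, MonoidHom.comp_apply, tauGL_coe]; rfl

/-! ### Integrality -/

theorem mem_of_units_conj_mem {M : Type*} [Monoid M] {S : Submonoid M} {u : Mˣ} {a : M}
    (hu : (u : M) ∈ S) (hu_inv : ((u⁻¹ : Mˣ) : M) ∈ S) (h : u * a * (u⁻¹ : Mˣ) ∈ S) : a ∈ S := by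
  have ha : (u⁻¹ : Mˣ) * (u * a * (u⁻¹ : Mˣ)) * u = a := by
    simp only [mul_assoc, Units.inv_mul_cancel_left, Units.inv_mul, mul_one]
  exact ha ▸ mul_mem (mul_mem hu_inv h) hu

theorem coeff_three_Wt_zero_zero : coeff 3 (Wt 0 0) = -(11 / 2) := by
  have hWt : Wt 0 0 = -(invSqrt * X) := by simp [Wt]
  rw [hWt, map_neg, coeff_succ_mul_X, coeff_two_invSqrt]

theorem not_isIntegerMatrix_gammaInv_Wt : ¬ IsIntegerMatrix (gammaInv Wt) := by
  intro h
  obtain ⟨n, hn⟩ := h (blockIndex.symm (0, 0)) (blockIndex.symm (3, 0))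
  rw [entry_gammaInv_blockIndex_symm, if_pos (Nat.zero_le _), Nat.sub_zero,
    coeff_three_Wt_zero_zero] at hn
  have h_two_mul : ((-11 : ℤ) : ℂ) = ((2 * n : ℤ) : ℂ) := by
    push_cast
    linear_combination 2 * hn
  have := Int.cast_injective h_two_mul
  omega

theorem tau1_mem_matricesOver (Y : SL(2, ℤ)) :
    (tau1 Y : ColFin) ∈ matricesOver (Int.castRingHom ℂ).range :=
  gammaInv_mem_matricesOver (seriesRepSL_apply_mem gSeries_mem_seriesOver Y)

section NegativeDeterminant

variable {Y : GL (Fin 2) ℤ}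

theorem not_isIntegerMatrix_tau1GL (hY : (Y : Matrix (Fin 2) (Fin 2) ℤ).det = -1) :
    ¬ IsIntegerMatrix (tau1GL Y) := by
  obtain ⟨A, rfl⟩ := exists_elemW_mul_coe_of_det_eq_neg_one hY
  intro h
  have hW : (tau1GL (elemW * A) : ColFin) * tau1 A⁻¹ = gammaInv Wt := by
    rw [← tau1GL_elemW, ← tau1GL_coe, ← Units.val_mul, ← map_mul, map_inv, mul_inv_cancel_right]
  rw [isIntegerMatrix_iff_mem_matricesOver] at h
  refine not_isIntegerMatrix_gammaInv_Wt (isIntegerMatrix_iff_mem_matricesOver.mpr ?_)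
  exact hW ▸ mul_mem h (tau1_mem_matricesOver A⁻¹)

theorem not_isIntegerMatrix_tauGL (hY : (Y : Matrix (Fin 2) (Fin 2) ℤ).det = -1) :
    ¬ IsIntegerMatrix (tauGL Y) := by
  refine mt (fun h => ?_) (not_isIntegerMatrix_tau1GL hY)
  rw [isIntegerMatrix_iff_mem_matricesOver] at h ⊢
  exact mem_of_units_conj_mem (S := (matricesOver _).toSubmonoid) matP_mem_matricesOver
    (isUpperUnitriangular_matP.inv_mem_matricesOver matP_mem_matricesOver) h

theorem not_isIntegerMatrix_rhoGL (hY : (Y : Matrix (Fin 2) (Fin 2) ℤ).det = -1) :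
    ¬ IsIntegerMatrix ((rhoGL Y : DR0) : ColFin) := by
  refine mt (fun h => ?_) (not_isIntegerMatrix_tauGL hY)
  rw [isIntegerMatrix_iff_mem_matricesOver] at h ⊢
  rw [coe_rhoGL] at h
  refine mem_matricesOver_of_psi_mem (mem_of_units_conj_mem (S := (matricesOver _).toSubmonoid)
    (u := matZ⁻¹) (isUpperUnitriangular_matZ.inv_mem_matricesOver matZ_mem_matricesOver) ?_ ?_)
  · rw [inv_inv]; exact matZ_mem_matricesOver
  · rw [inv_inv]; exact h

end NegativeDeterminant

end DivisorMatrix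

theorem mainTheorem7 :
    (Wt * Wt = 1 ∧ Wt.map PowerSeries.constantCoeff = !![0, 1; 1, 0] ∧
      ∃ C : ℝ, ∀ (i j : Fin 2) (n : ℕ),
        ‖PowerSeries.coeff n (Wt i j)‖ ≤ (2 : ℝ) ^ (C * (n : ℝ))) ∧
    ∃ (τ₁' τ' : GL (Fin 2) ℤ →* ColFinˣ) (ρ' : GL (Fin 2) ℤ →* DR0ˣ),
      (∀ Y : SL(2, ℤ), τ₁' (Y : GL (Fin 2) ℤ) = tau1 Y ∧ τ' (Y : GL (Fin 2) ℤ) = tau Y ∧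
        ((ρ' (Y : GL (Fin 2) ℤ) : DR0) : ColFin) = rho Y) ∧
      (τ₁' elemW : ColFin) = gammaInv Wt ∧
      (∀ Y : GL (Fin 2) ℤ, τ' Y = matP * τ₁' Y * matP⁻¹) ∧
      (∀ Y : GL (Fin 2) ℤ, ((ρ' Y : DR0) : ColFin) = (matZ⁻¹ : ColFinˣ) * psi (τ' Y) * matZ) ∧
      (∀ Y : GL (Fin 2) ℤ, (Y : Matrix (Fin 2) (Fin 2) ℤ).det = -1 →
        ¬ IsIntegerMatrix (τ₁' Y) ∧ ¬ IsIntegerMatrix (τ' Y) ∧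
          ¬ IsIntegerMatrix ((ρ' Y : DR0) : ColFin)) :=
  ⟨⟨Wt_mul_self, map_constantCoeff_Wt, exists_norm_coeff_Wt_le⟩,
    tau1GL, tauGL, rhoGL,
    fun Y => ⟨tau1GL_coe Y, tauGL_coe Y, coe_rhoGL_coe Y⟩,
    tau1GL_elemW,
    tauGL_apply,
    coe_rhoGL,
    fun _ hY => ⟨not_isIntegerMatrix_tau1GL hY, not_isIntegerMatrix_tauGL hY,
      not_isIntegerMatrix_rhoGL hY⟩⟩
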